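/- Let $F$ be the free group on a finite set $X=\{x_1,\dots,x_n\}$. Write $g^h=h^{-1}gh$, $H^g=g^{-1}Hg$ and $A^B=\{a^b : a\in A,\ b\in B\}$. For $S\subseteq F$ and $g\in F$, the order of $g$ in $S$ is the least $k\ge 1$ with $g^k\in S$, and $0$ if there is none; let $F_k(S)$ be the set of elements of $F$ of order $k$ in $S$. For $H\le F$, the Schreier automaton $\mathrm{Sch}(H)$ has the right cosets of $H$ as vertices and an arc $Hg\to Hga$ labelled $a$ for every coset $Hg$ and every letter $a\in X^{\pm1}$; a walk is reduced if it has no backtracking. The coset Stallings automaton $\mathrm{St}(Hu)$ is the full subgraph on the vertices that appear in some reduced walk from $H$ to $Hu$, and $\mathrm{St}(H)$ is the case $u=1$. The restricted Stallings automaton $\mathrm{St}^*(H)$ is obtained from $\mathrm{St}(H)$ by removing all hanging trees (a hanging tree is a tree glued to the rest of the graph at one vertex, and that vertex is kept). A trail of length $k\ge1$ is a sequence of vertices $q=(q_0,\dots,q_k)$ that are either pairwise different, or such that $q_0,\dots,q_{k-1}$ are pairwise different and $q_k=q_0$ (a closed trail). Its preorbit $F_q(H)$ is the set of $w\in F$ that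 label a walk in $\mathrm{Sch}(H)$ from $q_{i-1}$ to $q_i$ for every $i=1,\dots,k$. 1. There is an algorithm that, given a finite list of words generating a subgroup $H\le F$, a word $u$ and an integer $k\ge1$, decides whether $F_k(Hu)\neq\varnothing$ and, if so, computes finitely many elements $w_1,\dots,w_t\in F$, each of order $k$ in $Hu$, and a free basis of $H\cap H^u$, such that $$F_k(Hu)=\Big(\bigsqcup_{i=1}^{t}\big(H\cap H^{w_i}\cap H^{w_i^2}\cap\cdots\cap H^{w_i^{k-1}}\big)w_i\Big)^{H\cap H^u},$$ where the $t$ cosets inside the brackets are pairwise disjoint. In particular, the set $F_k(Hu)$ is computable, uniformly in $H$, $u$ and $k\ge 1$. 2. Let $H\le F$ be finitely generated, $u\in F$ and $k\ge1$. There are finitely many trails $q$ of length $k$ in $\mathrm{St}(Hu)$, and, whenever $v_q$ labels a walk from $q_0$ to $H$ and $v'_q$ labels a walk from $q_k$ to $Hu$ for every such $q$, $$F_k(Hu)=\bigcup_{q}\big(F_q(H)\big)^{v_qH\,\cap\,v'_qH^u},$$ where $q$ runs over these trails, and any two terms of the union are equal or disjoint. 3. Let $H\le F$ be finitely generated and $k\ge1$.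 There are finitely many closed trails $q$ of length $k$ in $\mathrm{St}^*(H)$, and, whenever $v_q$ labels a walk from $q_0$ to $H$ for every such $q$, $$F_k(H)=\Big(\bigcup_{q}\big(F_q(H)\big)^{v_q}\Big)^{H},$$ where $q$ runs over these closed trails, and any two of the sets $(F_q(H))^{v_q}$ are equal or disjoint. -/

import Mathlib

/-! ### Relative orders and conjugation in a group -/

section Groups

variable {G : Type*} [Group G]

/-- The relative order of `g` in `S`: the least `k ≥ 1` with `g ^ k ∈ S`, and `0` if there is none
(the infimum of the empty set of natural numbers is `0`). -/
noncomputable def relOrder (S : Set G) (g : G) : ℕ :=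
  sInf {k : ℕ | 1 ≤ k ∧ g ^ k ∈ S}

/-- The set of elements of `G` of order `k` in `S`. -/
def preorderSet (S : Set G) (k : ℕ) : Set G :=
  {g : G | relOrder S g = k}

/-- The right coset `K w`. -/
def rCoset (K : Subgroup G) (w : G) : Set G :=
  {x : G | ∃ h ∈ K, x = h * w}

/-- The left coset `w K`. -/
def lCoset (w : G) (K : Subgroup G) : Set G :=
  {x : G | ∃ h ∈ K, x = w * h}

/-- The conjugate subgroup `H ^ g = g⁻¹ H g`. -/
def conjSubgroup (H : Subgroup G) (g : G) : Subgroup G :=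
  H.map (MulAut.conj g⁻¹).toMonoidHom

/-- The set `A ^ B` of all conjugates `a ^ b = b⁻¹ a b` with `a ∈ A` and `b ∈ B`. -/
def conjSet (A B : Set G) : Set G :=
  {x : G | ∃ a ∈ A, ∃ b ∈ B, x = b⁻¹ * a * b}

/-- The coset `(H ∩ H ^ w ∩ H ^ (w ^ 2) ∩ ⋯ ∩ H ^ (w ^ (k - 1))) w`. -/
def orbitCoset (H : Subgroup G) (k : ℕ) (w : G) : Set G :=
  rCoset (⨅ j : Fin k, conjSubgroup H (w ^ (j : ℕ))) w

/-- The family `b` of elements of `G` is a free basis of the subgroup `K`. -/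
def IsFreeBasisOf {ι : Type*} (b : ι → G) (K : Subgroup G) : Prop :=
  ∃ B : FreeGroupBasis ι K, ∀ i, ((B i : K) : G) = b i

end Groups

/-! ### Involutive automata -/

/-- The letters of the involutive closure of the alphabet `X`: `(x, true)` is `x` and `(x, false)`
is the formal inverse of `x`. -/
abbrev Letter (X : Type*) := X × Bool

/-- An involutive labelled digraph, with vertices in `V` and labels in the involutive closure of
`X`. There is at most one arc with a given origin, label and end (which is no restriction for
deterministic automata), and arcs come in mutually inverse pairs. -/
structure InvDigraph (X V : Type*) where
  verts : Set V
  arc : V → Letter X → V → Prop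
  arc_left : ∀ {p a q}, arc p a q → p ∈ verts
  arc_inv : ∀ {p x b q}, arc p (x, b) q → arc q (x, !b) p

namespace InvDigraph

variable {X V : Type*}

/-- There is a walk from `p` to `q` with the given label. -/
def IsWalk (Γ : InvDigraph X V) : V → List (Letter X) → V → Prop
  | p, [], q => p ∈ Γ.verts ∧ p = q
  | p, a :: L, q => ∃ r, Γ.arc p a r ∧ Γ.IsWalk r L q

/-- The element `w` of the free group labels a walk from `p` to `q`. -/
def Reads (Γ : InvDigraph X V) (p : V) (w : FreeGroup X) (q : V) : Prop :=
  ∃ L : List (Letter X), FreeGroup.mk L = w ∧ Γ.IsWalk p L q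

/-- The full subgraph on a set of vertices. -/
def induce (Γ : InvDigraph X V) (S : Set V) : InvDigraph X V where
  verts := Γ.verts ∩ S
  arc p a q := Γ.arc p a q ∧ p ∈ S ∧ q ∈ S
  arc_left h := ⟨Γ.arc_left h.1, h.2.1⟩
  arc_inv h := ⟨Γ.arc_inv h.1, h.2.2, h.2.1⟩

/-- The core of a deterministic involutive automaton with initial vertex `p` and terminal vertex
`q`: the full subgraph on the vertices that appear in some reduced walk from `p` to `q`. (In a
deterministic involutive digraph a walk has no backtracking exactly if its label is reduced.) -/
def core (Γ : InvDigraph X V) (p q : V) : InvDigraph X V :=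
  Γ.induce {x | ∃ L₁ L₂ : List (Letter X),
    FreeGroup.IsReduced (L₁ ++ L₂) ∧ Γ.IsWalk p L₁ x ∧ Γ.IsWalk x L₂ q}

/-- A (deterministic, involutive) digraph is a tree if it is nonempty and any two vertices are
joined by exactly one reduced walk. -/
def IsTree (Γ : InvDigraph X V) : Prop :=
  Γ.verts.Nonempty ∧ ∀ p ∈ Γ.verts, ∀ q ∈ Γ.verts,
    ∃! L : List (Letter X), FreeGroup.IsReduced L ∧ Γ.IsWalk p L q

/-- The subgraph on the vertex set `T` whose arcs are the arcs of `Γ` between vertices of `T`,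
except for the loops at `a`. -/
def branch (Γ : InvDigraph X V) (T : Set V) (a : V) : InvDigraph X V where
  verts := Γ.verts ∩ T
  arc p l q := Γ.arc p l q ∧ p ∈ T ∧ q ∈ T ∧ (p ≠ a ∨ q ≠ a)
  arc_left h := ⟨Γ.arc_left h.1, h.2.1⟩
  arc_inv h := ⟨Γ.arc_inv h.1, h.2.2.1, h.2.1, h.2.2.2.symm⟩

/-- `T` is the vertex set of a hanging tree of `Γ`, glued to the rest of `Γ` at the vertex `a`. -/
def IsHangingTree (Γ : InvDigraph X V) (T : Set V) (a : V) : Prop :=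
  T ⊆ Γ.verts ∧ a ∈ T ∧ (Γ.branch T a).IsTree ∧
    ∀ p ∈ T, p ≠ a → ∀ l q, Γ.arc p l q → q ∈ T

/-- The restricted core: all hanging trees are removed (the vertex at which a hanging tree is glued
is not removed with that tree). -/
def restrictedCore (Γ : InvDigraph X V) : InvDigraph X V :=
  Γ.induce {x | ¬ ∃ T a, Γ.IsHangingTree T a ∧ x ∈ T ∧ x ≠ a}

/-- An open trail of length `k`: a sequence `(q₀, …, q_k)` of pairwise different vertices. -/
def IsOpenTrail (Γ : InvDigraph X V) {k : ℕ} (q : Fin (k + 1) → V) : Prop :=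
  (∀ i, q i ∈ Γ.verts) ∧ Function.Injective q

/-- A closed trail of length `k ≥ 1`: a sequence `(q₀, …, q_{k-1}, q_k = q₀)` of vertices with
`q₀, …, q_{k-1}` pairwise different. -/
def IsClosedTrail (Γ : InvDigraph X V) {k : ℕ} (q : Fin (k + 1) → V) : Prop :=
  0 < k ∧ (∀ i, q i ∈ Γ.verts) ∧ Function.Injective (fun i : Fin k => q i.castSucc) ∧
    q (Fin.last k) = q 0

/-- A trail is an open or a closed trail. -/
def IsTrail (Γ : InvDigraph X V) {k : ℕ} (q : Fin (k + 1) → V) : Prop :=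
  Γ.IsOpenTrail q ∨ Γ.IsClosedTrail q

/-- The preorbit of a finite trail: the elements that can be read between any two successive
vertices. -/
def preorbit (Γ : InvDigraph X V) {k : ℕ} (q : Fin (k + 1) → V) : Set (FreeGroup X) :=
  {w | ∀ i : Fin k, Γ.Reads (q i.castSucc) w (q i.succ)}

end InvDigraph

/-! ### Schreier and Stallings automata of subgroups of a free group -/

section Stallings

variable {X : Type*}

/-- The set `H \ F` of right cosets of `H`. -/
abbrev RightCosets (H : Subgroup (FreeGroup X)) := Quotient (QuotientGroup.rightRel H)

/-- The right coset `H g`, as a vertex of the Schreier automaton. -/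
def cosetVertex (H : Subgroup (FreeGroup X)) (g : FreeGroup X) : RightCosets H :=
  Quotient.mk (QuotientGroup.rightRel H) g

/-- The underlying digraph of the Schreier automaton of `H`: arcs `H g → H g a` with label `a`. -/
def schreier (H : Subgroup (FreeGroup X)) : InvDigraph X (RightCosets H) where
  verts := Set.univ
  arc p a q := ∃ g, p = cosetVertex H g ∧ q = cosetVertex H (g * FreeGroup.mk [a])
  arc_left _ := Set.mem_univ _
  arc_inv := by
    rintro p x b q ⟨g, rfl, rfl⟩
    refine ⟨g * FreeGroup.mk [(x, b)], rfl, ?_⟩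
    have h : FreeGroup.mk [(x, b)] * FreeGroup.mk [(x, !b)] = 1 := by
      have : FreeGroup.mk [(x, !b)] = (FreeGroup.mk [(x, b)])⁻¹ := by
        simp [FreeGroup.inv_mk, FreeGroup.invRev]
      rw [this, mul_inv_cancel]
    rw [mul_assoc, h, mul_one]

/-- The coset Stallings automaton of `H u`: the core of the Schreier automaton of `H` with initial
vertex `H` and terminal vertex `H u`. -/
def cosetStallings (H : Subgroup (FreeGroup X)) (u : FreeGroup X) :
    InvDigraph X (RightCosets H) :=
  (schreier H).core (cosetVertex H 1) (cosetVertex H u)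

/-- The restricted Stallings automaton of `H`: the restricted core of the Stallings automaton. -/
def restrictedStallings (H : Subgroup (FreeGroup X)) : InvDigraph X (RightCosets H) :=
  (cosetStallings H 1).restrictedCore

/-- The subgroup of the free group generated by a finite list of words. -/
def spanWords (S : List (List (Letter X))) : Subgroup (FreeGroup X) :=
  Subgroup.closure {g | ∃ L ∈ S, g = FreeGroup.mk L}

end Stallings

/-!
An element `z` has order `k` in `H u` exactly when its power path `H, H z, …, H z ^ k` in the
Schreier automaton is a trail that ends at `H u`. Translating the path by `c` amounts to conjugating
`z` by `c`. If `z = c d c⁻¹` with `d` cyclically reduced, then the translate by `c` runs along the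
reduced word of `z ^ k`, hence inside `St(H u)`, which is finite when `H` is finitely generated; for
`u = 1` it is moreover traversed by closed reduced walks, so it avoids the hanging trees.

The coset `(H ∩ H ^ w ∩ ⋯ ∩ H ^ (w ^ (k - 1))) w` consists of the elements with the same power path
as `w`. A walk read simultaneously from several vertices of a finite automaton can be cut as soon as
two of the tuples of vertices on it coincide; this bounds the length of the representatives `w`,
and of a Schreier tree of `H ∩ H ^ u`, whose chords give the free basis. Membership in `H` is
decidable because a word outside `H` moves the base point in an action on a set of bounded size.
-/

section GroupCosets

variable {G : Type*} [Group G] {H : Subgroup G} {S : Set G} {g u x : G} {k : ℕ}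

theorem mem_rCoset_iff : x ∈ rCoset H u ↔ x * u⁻¹ ∈ H :=
  ⟨by rintro ⟨h, hh, rfl⟩; simpa using hh, fun h => ⟨_, h, by simp⟩⟩

theorem mem_lCoset_iff : x ∈ lCoset u H ↔ u⁻¹ * x ∈ H :=
  ⟨by rintro ⟨h, hh, rfl⟩; simpa using hh, fun h => ⟨_, h, by simp⟩⟩

theorem rCoset_one : rCoset H 1 = (H : Set G) := by
  ext x
  simp [mem_rCoset_iff]

theorem mem_conjSubgroup_iff : x ∈ conjSubgroup H u ↔ u * x * u⁻¹ ∈ H := by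
  rw [conjSubgroup, Subgroup.mem_map]
  constructor
  · rintro ⟨h, hh, rfl⟩
    simpa [mul_assoc] using hh
  · exact fun h => ⟨_, h, by simp [mul_assoc]⟩

theorem mem_conjSet_singleton_iff {A : Set G} : x ∈ conjSet A {u} ↔ u * x * u⁻¹ ∈ A := by
  constructor
  · rintro ⟨a, ha, _, rfl, rfl⟩
    simpa [mul_assoc] using ha
  · exact fun h => ⟨_, h, u, rfl, by group⟩

theorem mem_preorderSet_iff (hk : 1 ≤ k) :
    g ∈ preorderSet S k ↔ g ^ k ∈ S ∧ ∀ j, 1 ≤ j → j < k → g ^ j ∉ S := by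
  change sInf {j : ℕ | 1 ≤ j ∧ g ^ j ∈ S} = k ↔ _
  constructor
  · rintro rfl
    exact ⟨(Nat.sInf_mem (Nat.nonempty_of_pos_sInf hk)).2,
      fun j hj hlt hmem => Nat.notMem_of_lt_sInf hlt ⟨hj, hmem⟩⟩
  · rintro ⟨hmem, hmin⟩
    have hleast : IsLeast {j : ℕ | 1 ≤ j ∧ g ^ j ∈ S} k :=
      ⟨⟨hk, hmem⟩, fun j hj => not_lt.mp fun hlt => hmin j hj.1 hlt hj.2⟩
    exact hleast.csInf_eq

end GroupCosets

theorem pairwiseDisjoint_image_of_eq_of_mem {ι α : Type*} {s : Set ι} {f : ι → Set α}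
    (hf : ∀ i ∈ s, ∀ j ∈ s, ∀ a ∈ f i, a ∈ f j → f i = f j) :
    (f '' s).PairwiseDisjoint id := by
  rintro _ ⟨i, hi, rfl⟩ _ ⟨j, hj, rfl⟩ hij
  exact Set.disjoint_left.mpr fun a hai haj => hij (hf i hi j hj a hai haj)

/-! ### The action on the right cosets -/

section Move

variable {X : Type*} {H : Subgroup (FreeGroup X)} {p q : RightCosets H} {g g' u w x : FreeGroup X}

/-- The right translate `p w` of a right coset `p`, that is, the end of the walk of the Schreier
automaton which starts at `p` and is labelled by `w`. -/
def move (p : RightCosets H) (w : FreeGroup X) : RightCosets H :=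
  Quotient.map' (s₁ := QuotientGroup.rightRel H) (s₂ := QuotientGroup.rightRel H) (· * w)
    (fun a b h => by
      rw [QuotientGroup.rightRel_apply] at h ⊢
      simpa [mul_assoc] using h) p

@[simp]
theorem move_cosetVertex (g w : FreeGroup X) :
    move (cosetVertex H g) w = cosetVertex H (g * w) := rfl

theorem exists_cosetVertex (p : RightCosets H) : ∃ g, p = cosetVertex H g :=
  p.inductionOn fun g => ⟨g, rfl⟩

@[simp]
theorem move_one (p : RightCosets H) : move p 1 = p := by
  obtain ⟨g, rfl⟩ := exists_cosetVertex p
  simp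

theorem move_mul (p : RightCosets H) (w w' : FreeGroup X) :
    move p (w * w') = move (move p w) w' := by
  obtain ⟨g, rfl⟩ := exists_cosetVertex p
  simp [mul_assoc]

theorem move_eq_iff : move p w = q ↔ p = move q w⁻¹ := by
  constructor <;> rintro rfl <;> simp [← move_mul]

theorem move_injective (w : FreeGroup X) :
    Function.Injective (fun p : RightCosets H => move p w) :=
  fun p q (h : move p w = move q w) => by simpa [← move_mul] using move_eq_iff.mp h

theorem cosetVertex_eq_iff : cosetVertex H g = cosetVertex H g' ↔ g' * g⁻¹ ∈ H := by
  rw [cosetVertex, cosetVertex, Quotient.eq, QuotientGroup.rightRel_apply]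

theorem cosetVertex_mul_eq_iff :
    cosetVertex H (g * w) = cosetVertex H (g' * w) ↔ cosetVertex H g = cosetVertex H g' :=
  (move_injective w).eq_iff (a := cosetVertex H g) (b := cosetVertex H g')

theorem cosetVertex_eq_one_iff : cosetVertex H x = cosetVertex H 1 ↔ x ∈ H := by
  rw [eq_comm, cosetVertex_eq_iff, inv_one, mul_one]

theorem mem_rCoset_iff_cosetVertex_eq :
    x ∈ rCoset H u ↔ cosetVertex H x = cosetVertex H u := by
  rw [eq_comm, cosetVertex_eq_iff, mem_rCoset_iff]

theorem mem_conjSubgroup_iff_cosetVertex_eq :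
    x ∈ conjSubgroup H u ↔ cosetVertex H (u * x) = cosetVertex H u := by
  rw [eq_comm, cosetVertex_eq_iff, mem_conjSubgroup_iff]

theorem mem_lCoset_conjSubgroup_iff (hw : move p w = cosetVertex H u) :
    x ∈ lCoset w (conjSubgroup H u) ↔ move p x = cosetVertex H u := by
  rw [mem_lCoset_iff, mem_conjSubgroup_iff_cosetVertex_eq, move_eq_iff.mp hw, move_cosetVertex,
    move_cosetVertex, mul_assoc]

theorem mem_lCoset_iff_move (hw : move p w = cosetVertex H 1) :
    x ∈ lCoset w H ↔ move p x = cosetVertex H 1 := by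
  rw [mem_lCoset_iff, ← cosetVertex_eq_one_iff, move_eq_iff.mp hw, move_cosetVertex,
    move_cosetVertex, one_mul]

theorem schreier_arc_iff {a : Letter X} :
    (schreier H).arc p a q ↔ move p (FreeGroup.mk [a]) = q := by
  constructor
  · rintro ⟨g, rfl, rfl⟩
    rfl
  · rintro rfl
    obtain ⟨g, rfl⟩ := exists_cosetVertex p
    exact ⟨g, rfl, rfl⟩

theorem schreier_isWalk_iff {L : List (Letter X)} :
    (schreier H).IsWalk p L q ↔ move p (FreeGroup.mk L) = q := by
  induction L generalizing p with
  | nil => simp [← FreeGroup.one_eq_mk, InvDigraph.IsWalk, schreier]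
  | cons a L ih =>
    have hcons : FreeGroup.mk (a :: L) = FreeGroup.mk [a] * FreeGroup.mk L := by
      rw [FreeGroup.mul_mk, List.singleton_append]
    rw [hcons, move_mul]
    simp [InvDigraph.IsWalk, schreier_arc_iff, ih]

theorem schreier_reads_iff : (schreier H).Reads p w q ↔ move p w = q := by
  simp only [InvDigraph.Reads, schreier_isWalk_iff]
  constructor
  · rintro ⟨L, rfl, h⟩
    exact h
  · obtain ⟨L, rfl⟩ := Quot.exists_rep w
    exact fun h => ⟨L, rfl, h⟩

theorem mem_preorbit_schreier_iff {k : ℕ} {q : Fin (k + 1) → RightCosets H} :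
    w ∈ (schreier H).preorbit q ↔ ∀ i : Fin k, move (q i.castSucc) w = q i.succ := by
  simp [InvDigraph.preorbit, schreier_reads_iff]

end Move

/-! ### Walks in involutive digraphs -/

namespace InvDigraph

variable {X V : Type*} {Γ : InvDigraph X V} {p q r x y : V} {L M : List (Letter X)}

theorem arc_right {a : Letter X} (h : Γ.arc p a q) : q ∈ Γ.verts :=
  Γ.arc_left (Γ.arc_inv h)

theorem IsWalk.left_mem (h : Γ.IsWalk p L q) : p ∈ Γ.verts := by
  cases L with
  | nil => exact h.1
  | cons a L => exact Γ.arc_left h.choose_spec.1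

theorem isWalk_append_iff :
    Γ.IsWalk p (L ++ M) q ↔ ∃ r, Γ.IsWalk p L r ∧ Γ.IsWalk r M q := by
  induction L generalizing p with
  | nil =>
    exact ⟨fun h => ⟨p, ⟨h.left_mem, rfl⟩, h⟩, by rintro ⟨r, ⟨-, rfl⟩, h⟩; exact h⟩
  | cons a L ih =>
    simp only [List.cons_append, IsWalk, ih]
    grind

theorem IsWalk.right_mem (h : Γ.IsWalk p L q) : q ∈ Γ.verts := by
  obtain ⟨r, -, hr, rfl⟩ := isWalk_append_iff.mp (L.append_nil.symm ▸ h)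
  exact hr

theorem IsWalk.invRev (h : Γ.IsWalk p L q) : Γ.IsWalk q (FreeGroup.invRev L) p := by
  induction L generalizing p with
  | nil => exact ⟨h.2 ▸ h.1, h.2.symm⟩
  | cons a L ih =>
    obtain ⟨r, har, hr⟩ := h
    have hinv : FreeGroup.invRev (a :: L) = FreeGroup.invRev L ++ [(a.1, !a.2)] := by
      simp [FreeGroup.invRev]
    rw [hinv, isWalk_append_iff]
    exact ⟨r, ih hr, p, Γ.arc_inv har, Γ.arc_left har, rfl⟩

theorem Reads.mul {w w' : FreeGroup X} (h : Γ.Reads p w q) (h' : Γ.Reads q w' r) :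
    Γ.Reads p (w * w') r := by
  obtain ⟨L, rfl, hL⟩ := h
  obtain ⟨M, rfl, hM⟩ := h'
  exact ⟨L ++ M, FreeGroup.mul_mk.symm, isWalk_append_iff.mpr ⟨q, hL, hM⟩⟩

theorem Reads.inv {w : FreeGroup X} (h : Γ.Reads p w q) : Γ.Reads q w⁻¹ p := by
  obtain ⟨L, rfl, hL⟩ := h
  exact ⟨FreeGroup.invRev L, FreeGroup.inv_mk.symm, hL.invRev⟩

/-- A digraph is deterministic if no two arcs with the same label leave the same vertex. -/
def IsDeterministic (Γ : InvDigraph X V) : Prop :=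
  ∀ ⦃p a q q'⦄, Γ.arc p a q → Γ.arc p a q' → q = q'

theorem IsDeterministic.isWalk_of_red (hΓ : Γ.IsDeterministic) (h : Γ.IsWalk p L q)
    (hLM : FreeGroup.Red L M) : Γ.IsWalk p M q := by
  induction hLM with
  | refl => exact h
  | tail _ hstep ih =>
    cases hstep with
    | @not L₁ L₂ x b =>
      obtain ⟨r, hr, r', hrr', s, hs, hL₂⟩ := isWalk_append_iff.mp ih
      obtain rfl : r = s := hΓ (by simpa using Γ.arc_inv hrr') hs
      exact isWalk_append_iff.mpr ⟨r, hr, hL₂⟩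

theorem IsDeterministic.isWalk_of_reads (hΓ : Γ.IsDeterministic) (hL : FreeGroup.IsReduced L)
    (h : Γ.Reads p (FreeGroup.mk L) q) : Γ.IsWalk p L q := by
  classical
  obtain ⟨M, hML, hM⟩ := h
  rw [← FreeGroup.toWord_inj, FreeGroup.toWord_mk, FreeGroup.toWord_mk, hL.reduce_eq] at hML
  exact hML ▸ hΓ.isWalk_of_red hM FreeGroup.reduce.red

theorem core_isWalk {L₁ L₂ : List (Letter X)} (hred : FreeGroup.IsReduced (L₁ ++ M ++ L₂))
    (h₁ : Γ.IsWalk p L₁ x) (h : Γ.IsWalk x M y) (h₂ : Γ.IsWalk y L₂ q) :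
    (Γ.core p q).IsWalk x M y := by
  induction M generalizing x L₁ with
  | nil =>
    obtain ⟨hx, rfl⟩ := h
    exact ⟨⟨hx, L₁, L₂, by simpa using hred, h₁, h₂⟩, rfl⟩
  | cons a M ih =>
    obtain ⟨z, ha, hz⟩ := h
    have hxq : Γ.IsWalk x (a :: M ++ L₂) q := isWalk_append_iff.mpr ⟨y, ⟨z, ha, hz⟩, h₂⟩
    have hpz : Γ.IsWalk p (L₁ ++ [a]) z :=
      isWalk_append_iff.mpr ⟨x, h₁, z, ha, arc_right ha, rfl⟩
    have hzy : (Γ.core p q).IsWalk z M y := ih (by simpa using hred) hpz hz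
    exact ⟨z, ⟨ha, ⟨L₁, _, by simpa using hred, h₁, hxq⟩, hzy.left_mem.2⟩, hzy⟩

section ShortWalks

variable {ι : Type*} [Fintype ι] {a b : ι → V}

/-- The vertices reached after `j` steps form a family in `Γ.verts ^ ι`; two such families coincide
and the part of the walks in between can be cut out. -/
theorem exists_shorter_walk (hΓ : Γ.verts.Finite) (h : ∀ i, Γ.IsWalk (a i) L (b i))
    (hL : Γ.verts.ncard ^ Fintype.card ι < L.length) :
    ∃ M : List (Letter X), M.length < L.length ∧ ∀ i, Γ.IsWalk (a i) M (b i) := by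
  classical
  have : Fintype Γ.verts := hΓ.fintype
  have hsplit : ∀ (j : Fin (L.length + 1)) i, ∃ r, Γ.IsWalk (a i) (L.take j) r ∧
      Γ.IsWalk r (L.drop j) (b i) := fun j i =>
    isWalk_append_iff.mp ((L.take_append_drop j).symm ▸ h i)
  choose c hc hc' using hsplit
  have hcard : Fintype.card (ι → Γ.verts) < Fintype.card (Fin (L.length + 1)) := by
    rw [Fintype.card_fun, Fintype.card_fin, ← Nat.card_eq_fintype_card (α := Γ.verts),
      Nat.card_coe_set_eq]
    omega
  obtain ⟨j, j', hne, hj⟩ := Fintype.exists_ne_map_eq_of_card_lt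
    (fun j i => (⟨c j i, (hc' j i).left_mem⟩ : Γ.verts)) hcard
  wlog hlt : j < j' generalizing j j'
  · exact this j' j hne.symm hj.symm (hne.symm.lt_of_le (not_lt.mp hlt))
  refine ⟨L.take j ++ L.drop j', ?_, fun i => isWalk_append_iff.mpr ⟨c j i, hc j i, ?_⟩⟩
  · rw [List.length_append, List.length_take, List.length_drop]
    omega
  · have hji : c j i = c j' i := congrArg Subtype.val (congrFun hj i)
    exact hji ▸ hc' j' i

theorem exists_short_walk (hΓ : Γ.verts.Finite) (h : ∀ i, Γ.IsWalk (a i) L (b i)) :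
    ∃ M : List (Letter X), M.length ≤ Γ.verts.ncard ^ Fintype.card ι ∧
      ∀ i, Γ.IsWalk (a i) M (b i) := by
  induction hn : L.length using Nat.strong_induction_on generalizing L with
  | _ n ih =>
    subst hn
    by_cases hL : L.length ≤ Γ.verts.ncard ^ Fintype.card ι
    · exact ⟨L, hL, h⟩
    · obtain ⟨M, hML, hM⟩ := exists_shorter_walk hΓ h (not_le.mp hL)
      exact ih _ hML hM rfl

end ShortWalks

section HangingTrees

variable {T : Set V} {a : V}

theorem IsHangingTree.isWalk_branch (hT : Γ.IsHangingTree T a) (hx : x ∈ T) (hxa : x ≠ a)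
    (h : Γ.IsWalk x L y) :
    (∃ M, M <+: L ∧ (Γ.branch T a).IsWalk x M a) ∨ (Γ.branch T a).IsWalk x L y := by
  induction L generalizing x with
  | nil => exact Or.inr ⟨⟨h.1, hx⟩, h.2⟩
  | cons l L ih =>
    obtain ⟨z, hxz, hz⟩ := h
    have hzT : z ∈ T := hT.2.2.2 x hx hxa l z hxz
    have harc : (Γ.branch T a).arc x l z := ⟨hxz, hx, hzT, Or.inl hxa⟩
    by_cases hza : z = a
    · exact Or.inl ⟨[l], ⟨L, rfl⟩, z, harc, arc_right harc, hza⟩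
    · rcases ih hzT hza hz with ⟨M, hML, hM⟩ | hL
      · exact Or.inl ⟨l :: M, by simpa using hML, z, harc, hM⟩
      · exact Or.inr ⟨z, harc, hL⟩

theorem IsHangingTree.exists_prefix_isWalk_root (hT : Γ.IsHangingTree T a) (hx : x ∈ T)
    (hxa : x ≠ a) (hL : FreeGroup.IsReduced L) (hne : L ≠ []) (h : Γ.IsWalk x L x) :
    ∃ M, M <+: L ∧ (Γ.branch T a).IsWalk x M a := by
  refine (hT.isWalk_branch hx hxa h).resolve_right fun hbranch => hne ?_
  have hxv : x ∈ (Γ.branch T a).verts := ⟨h.left_mem, hx⟩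
  exact (hT.2.2.1.2 x hxv x hxv).unique ⟨hL, hbranch⟩ ⟨by simp, hxv, rfl⟩

/-- Both `D` and its inverse would have to start with the reduced walk from `x` to the root, so that
the first letter of `D` would be inverse to the last one. -/
theorem IsHangingTree.eq_root_of_isWalk {D : List (Letter X)} (hT : Γ.IsHangingTree T a)
    (hx : x ∈ T) (hD : FreeGroup.IsCyclicallyReduced D) (hne : D ≠ []) (h : Γ.IsWalk x D x) :
    x = a := by
  classical
  by_contra hxa
  have hDinv : FreeGroup.IsReduced (FreeGroup.invRev D) := by
    rw [FreeGroup.isReduced_iff_reduce_eq, FreeGroup.reduce_invRev, hD.isReduced.reduce_eq]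
  obtain ⟨M, hMD, hM⟩ := hT.exists_prefix_isWalk_root hx hxa hD.isReduced hne h
  obtain ⟨M', hMD', hM'⟩ := hT.exists_prefix_isWalk_root hx hxa hDinv
    (by simpa [FreeGroup.invRev] using hne) h.invRev
  obtain rfl : M = M' := (hT.2.2.1.2 x ⟨h.left_mem, hx⟩ a ⟨hT.1 hT.2.1, hT.2.1⟩).unique
    ⟨hD.isReduced.infix hMD.isInfix, hM⟩ ⟨hDinv.infix hMD'.isInfix, hM'⟩
  obtain _ | ⟨b, M⟩ := M
  · exact hxa hM.2
  obtain ⟨R, rfl⟩ := hMD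
  obtain ⟨R', hR'⟩ := hMD'
  have hlast : ((b :: M) ++ R).getLast? = some (b.1, !b.2) := by
    rw [← FreeGroup.invRev_invRev (L₁ := (b :: M) ++ R), ← hR']
    simp [FreeGroup.invRev]
  simpa using hD.2 _ hlast b rfl rfl

end HangingTrees

end InvDigraph

/-! ### The digraph traced by a list of generators -/

section Trace

variable {X : Type*}

/-- The list of all prefixes of `u` and of the words of `S`; their cosets are the vertices of
`tracedGraph S u`. -/
def prefixList (S : List (List (Letter X))) (u : List (Letter X)) : List (List (Letter X)) :=
  (u :: S).flatMap List.inits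

/-- The list of the elements of the alphabet that occur in `u` or in a word of `S`. -/
def letterList (S : List (List (Letter X))) (u : List (Letter X)) : List X :=
  (u :: S).flatten.map Prod.fst

variable {S : List (List (Letter X))} {u p : List (Letter X)}

theorem mem_prefixList_iff : p ∈ prefixList S u ↔ ∃ L ∈ u :: S, p <+: L := by
  simp only [prefixList, List.mem_flatMap, List.mem_inits]

theorem mem_prefixList_of_prefix {p' : List (Letter X)} (hp : p ∈ prefixList S u) (h : p' <+: p) :
    p' ∈ prefixList S u := by
  obtain ⟨L, hL, hpL⟩ := mem_prefixList_iff.mp hp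
  exact mem_prefixList_iff.mpr ⟨L, hL, h.trans hpL⟩

theorem nil_mem_prefixList : [] ∈ prefixList S u :=
  mem_prefixList_iff.mpr ⟨u, List.mem_cons_self, List.nil_prefix⟩

theorem self_mem_prefixList : u ∈ prefixList S u :=
  mem_prefixList_iff.mpr ⟨u, List.mem_cons_self, List.prefix_rfl⟩

theorem mem_prefixList_of_mem {L : List (Letter X)} (hL : L ∈ S) : L ∈ prefixList S u :=
  mem_prefixList_iff.mpr ⟨L, List.mem_cons_of_mem u hL, List.prefix_rfl⟩

theorem fst_mem_letterList (hp : p ∈ prefixList S u) {a : Letter X} (ha : a ∈ p) :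
    a.1 ∈ letterList S u := by
  obtain ⟨L, hL, hpL⟩ := mem_prefixList_iff.mp hp
  exact List.mem_map_of_mem (List.mem_flatten_of_mem hL (hpL.subset ha))

/-- The subgraph of the Schreier automaton of `spanWords S` on the vertices passed when `u` and the
words of `S` are read from the base vertex. Only the letters that occur in these words are admitted
as labels, so that there are finitely many arcs even if the alphabet is infinite. -/
def tracedGraph (S : List (List (Letter X))) (u : List (Letter X)) :
    InvDigraph X (RightCosets (spanWords S)) where
  verts := (fun p => cosetVertex (spanWords S) (FreeGroup.mk p)) '' {p | p ∈ prefixList S u}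
  arc v a w := (schreier (spanWords S)).arc v a w ∧ a.1 ∈ letterList S u ∧
    v ∈ (fun p => cosetVertex (spanWords S) (FreeGroup.mk p)) '' {p | p ∈ prefixList S u} ∧
    w ∈ (fun p => cosetVertex (spanWords S) (FreeGroup.mk p)) '' {p | p ∈ prefixList S u}
  arc_left h := h.2.2.1
  arc_inv h := ⟨(schreier (spanWords S)).arc_inv h.1, h.2.1, h.2.2.2, h.2.2.1⟩

theorem finite_tracedGraph_verts : (tracedGraph S u).verts.Finite :=
  (List.finite_toSet _).image _

theorem ncard_tracedGraph_verts_le : (tracedGraph S u).verts.ncard ≤ (prefixList S u).length := by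
  classical
  refine (Set.ncard_image_le (List.finite_toSet _)).trans ?_
  rw [← List.coe_toFinset, Set.ncard_coe_finset]
  exact List.toFinset_card_le _

theorem base_mem_tracedGraph_verts : cosetVertex (spanWords S) 1 ∈ (tracedGraph S u).verts :=
  ⟨[], nil_mem_prefixList, rfl⟩

theorem target_mem_tracedGraph_verts :
    cosetVertex (spanWords S) (FreeGroup.mk u) ∈ (tracedGraph S u).verts :=
  ⟨u, self_mem_prefixList, rfl⟩

theorem isDeterministic_tracedGraph : (tracedGraph S u).IsDeterministic := fun _ _ _ _ h h' =>
  (schreier_arc_iff.mp h.1).symm.trans (schreier_arc_iff.mp h'.1)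

theorem move_eq_of_tracedGraph_isWalk {v w : RightCosets (spanWords S)} {L : List (Letter X)}
    (h : (tracedGraph S u).IsWalk v L w) :
    move v (FreeGroup.mk L) = w ∧ ∀ a ∈ L, a.1 ∈ letterList S u := by
  rw [← schreier_isWalk_iff]
  induction L generalizing v with
  | nil => exact ⟨⟨Set.mem_univ v, h.2⟩, by simp⟩
  | cons a L ih =>
    obtain ⟨v', ha, hL⟩ := h
    exact ⟨⟨v', ha.1, (ih hL).1⟩, List.forall_mem_cons.mpr ⟨ha.2.1, (ih hL).2⟩⟩

theorem tracedGraph_isWalk_of_mem_prefixList (hp : p ∈ prefixList S u) :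
    (tracedGraph S u).IsWalk (cosetVertex (spanWords S) 1) p
      (cosetVertex (spanWords S) (FreeGroup.mk p)) := by
  induction p using List.reverseRecOn with
  | nil => exact ⟨base_mem_tracedGraph_verts, by rw [← FreeGroup.one_eq_mk]⟩
  | append_singleton p a ih =>
    have hp' := mem_prefixList_of_prefix hp (List.prefix_append p [a])
    refine InvDigraph.isWalk_append_iff.mpr
      ⟨_, ih hp', _, ⟨schreier_arc_iff.mpr ?_, fst_mem_letterList hp (by simp), ⟨p, hp', rfl⟩, ?_⟩,
        ⟨_, hp, rfl⟩, rfl⟩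
    · rw [move_cosetVertex, FreeGroup.mul_mk]
    · exact ⟨_, hp, rfl⟩

theorem tracedGraph_reads_base_of_mem {h : FreeGroup X} (hh : h ∈ spanWords S) :
    (tracedGraph S u).Reads (cosetVertex (spanWords S) 1) h (cosetVertex (spanWords S) 1) := by
  induction hh using Subgroup.closure_induction with
  | mem g hg =>
    obtain ⟨L, hL, rfl⟩ := hg
    have hbase : cosetVertex (spanWords S) (FreeGroup.mk L) = cosetVertex (spanWords S) 1 :=
      cosetVertex_eq_one_iff.mpr (Subgroup.subset_closure ⟨L, hL, rfl⟩)
    have hwalk := tracedGraph_isWalk_of_mem_prefixList (u := u) (mem_prefixList_of_mem hL)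
    rw [hbase] at hwalk
    exact ⟨L, rfl, hwalk⟩
  | one => exact ⟨[], rfl, base_mem_tracedGraph_verts, rfl⟩
  | mul g g' _ _ ihg ihg' => exact ihg.mul ihg'
  | inv g _ ih => exact ih.inv

theorem tracedGraph_reads_of_move_eq {v v' : RightCosets (spanWords S)} {w : FreeGroup X}
    (hv : v ∈ (tracedGraph S u).verts) (hv' : v' ∈ (tracedGraph S u).verts)
    (hw : move v w = v') : (tracedGraph S u).Reads v w v' := by
  obtain ⟨p, hp, rfl⟩ := hv
  obtain ⟨q, hq, rfl⟩ := hv'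
  have hp' : (tracedGraph S u).Reads _ _ _ := ⟨p, rfl, tracedGraph_isWalk_of_mem_prefixList hp⟩
  have hq' : (tracedGraph S u).Reads _ _ _ := ⟨q, rfl, tracedGraph_isWalk_of_mem_prefixList hq⟩
  rw [move_cosetVertex, eq_comm, cosetVertex_eq_iff] at hw
  have hreads := (hp'.inv.mul (tracedGraph_reads_base_of_mem hw)).mul hq'
  rwa [show (FreeGroup.mk p)⁻¹ * (FreeGroup.mk p * w * (FreeGroup.mk q)⁻¹) * FreeGroup.mk q = w by
    group] at hreads

theorem tracedGraph_isWalk_of_move_eq {v v' : RightCosets (spanWords S)} {L : List (Letter X)}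
    (hL : FreeGroup.IsReduced L) (hv : v ∈ (tracedGraph S u).verts)
    (hv' : v' ∈ (tracedGraph S u).verts) (h : move v (FreeGroup.mk L) = v') :
    (tracedGraph S u).IsWalk v L v' :=
  isDeterministic_tracedGraph.isWalk_of_reads hL (tracedGraph_reads_of_move_eq hv hv' h)

theorem exists_short_word {ι : Type*} [Fintype ι] [Nonempty ι]
    {v v' : ι → RightCosets (spanWords S)} {w : FreeGroup X}
    (hv : ∀ i, v i ∈ (tracedGraph S u).verts) (hv' : ∀ i, v' i ∈ (tracedGraph S u).verts)
    (hw : ∀ i, move (v i) w = v' i) :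
    ∃ M : List (Letter X), M.length ≤ (prefixList S u).length ^ Fintype.card ι ∧
      (∀ a ∈ M, a.1 ∈ letterList S u) ∧ ∀ i, move (v i) (FreeGroup.mk M) = v' i := by
  classical
  obtain ⟨M, hlen, hM⟩ := InvDigraph.exists_short_walk finite_tracedGraph_verts fun i =>
    tracedGraph_isWalk_of_move_eq (u := u) FreeGroup.isReduced_toWord (hv i) (hv' i)
      (by rw [FreeGroup.mk_toWord]; exact hw i)
  obtain ⟨i₀⟩ := ‹Nonempty ι›
  exact ⟨M, hlen.trans (Nat.pow_le_pow_left ncard_tracedGraph_verts_le _),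
    (move_eq_of_tracedGraph_isWalk (hM i₀)).2, fun i => (move_eq_of_tracedGraph_isWalk (hM i)).1⟩

theorem exists_spanWords_eq {H : Subgroup (FreeGroup X)} (hH : H.FG) :
    ∃ S : List (List (Letter X)), H = spanWords S := by
  classical
  obtain ⟨T, rfl⟩ := hH
  refine ⟨T.toList.map FreeGroup.toWord, congrArg Subgroup.closure (Set.ext fun g => ?_)⟩
  simp [eq_comm, FreeGroup.mk_toWord]

theorem cosetStallings_verts_subset :
    (cosetStallings (spanWords S) (FreeGroup.mk u)).verts ⊆ (tracedGraph S u).verts := by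
  rintro v ⟨-, L₁, L₂, hred, h₁, h₂⟩
  rw [schreier_isWalk_iff] at h₁ h₂
  obtain ⟨r, hr, hr'⟩ := InvDigraph.isWalk_append_iff.mp (tracedGraph_isWalk_of_move_eq (u := u)
    hred base_mem_tracedGraph_verts target_mem_tracedGraph_verts
    (by rw [← FreeGroup.mul_mk, move_mul, h₁, h₂]))
  rw [← h₁, (move_eq_of_tracedGraph_isWalk hr).1]
  exact hr'.left_mem

theorem finite_cosetStallings_verts {H : Subgroup (FreeGroup X)} (hH : H.FG) (u : FreeGroup X) :
    (cosetStallings H u).verts.Finite := by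
  obtain ⟨S, rfl⟩ := exists_spanWords_eq hH
  obtain ⟨u, rfl⟩ := Quot.exists_rep u
  exact finite_tracedGraph_verts.subset cosetStallings_verts_subset

end Trace

/-! ### Trails and relative orders -/

section NearlyInjective

variable {X V : Type*} {k : ℕ}

/-- The only coincidence between entries of the sequence `(q₀, …, q_k)` is possibly `q₀ = q_k`. -/
def NearlyInjective (q : Fin (k + 1) → V) : Prop :=
  ∀ i j, i < j → q i = q j → i = 0 ∧ j = Fin.last k

theorem nearlyInjective_comp_iff {W : Type*} {q : Fin (k + 1) → V} {f : V → W}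
    (hf : Function.Injective f) : NearlyInjective (fun i => f (q i)) ↔ NearlyInjective q := by
  simp only [NearlyInjective, hf.eq_iff]

variable {Γ : InvDigraph X V} {q : Fin (k + 1) → V}

theorem isClosedTrail_iff (hk : 1 ≤ k) : Γ.IsClosedTrail q ↔
    (∀ i, q i ∈ Γ.verts) ∧ NearlyInjective q ∧ q (Fin.last k) = q 0 := by
  constructor
  · rintro ⟨-, hv, hinj, hq⟩
    refine ⟨hv, fun i j hij h => ?_, hq⟩
    obtain ⟨i, rfl⟩ := Fin.exists_castSucc_eq.mpr (hij.trans_le (Fin.le_last j)).ne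
    induction j using Fin.lastCases with
    | last =>
      have hi : i = ⟨0, hk⟩ := hinj (h.trans hq)
      exact ⟨congrArg Fin.castSucc hi, rfl⟩
    | cast j => exact absurd (congrArg Fin.castSucc (hinj h)) hij.ne
  · rintro ⟨hv, hn, hq⟩
    refine ⟨hk, hv, fun i j h => ?_, hq⟩
    rcases lt_trichotomy i j with hij | hij | hij
    · exact absurd (hn _ _ (Fin.castSucc_lt_castSucc_iff.mpr hij) h).2 (Fin.castSucc_lt_last j).ne
    · exact hij
    · exact absurd (hn _ _ (Fin.castSucc_lt_castSucc_iff.mpr hij) h.symm).2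
        (Fin.castSucc_lt_last i).ne

theorem isTrail_iff (hk : 1 ≤ k) : Γ.IsTrail q ↔ (∀ i, q i ∈ Γ.verts) ∧ NearlyInjective q := by
  rw [InvDigraph.IsTrail, isClosedTrail_iff hk]
  constructor
  · rintro (⟨hv, hinj⟩ | ⟨hv, hn, -⟩)
    · exact ⟨hv, fun i j hij h => absurd (hinj h) hij.ne⟩
    · exact ⟨hv, hn⟩
  · rintro ⟨hv, hn⟩
    by_cases hq : q (Fin.last k) = q 0
    · exact Or.inr ⟨hv, hn, hq⟩
    refine Or.inl ⟨hv, fun i j h => ?_⟩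
    rcases lt_trichotomy i j with hij | hij | hij
    · obtain ⟨rfl, rfl⟩ := hn _ _ hij h
      exact absurd h.symm hq
    · exact hij
    · obtain ⟨rfl, rfl⟩ := hn _ _ hij h.symm
      exact absurd h hq

theorem finite_setOf_isTrail (hV : Γ.verts.Finite) :
    {q : Fin (k + 1) → V | Γ.IsTrail q}.Finite :=
  (Set.Finite.pi' fun _ => hV).subset fun _ hq i => hq.elim (fun h => h.1 i) (fun h => h.2.1 i)

end NearlyInjective

section Trails

variable {X : Type*} {H : Subgroup (FreeGroup X)} {k : ℕ} {q : Fin (k + 1) → RightCosets H}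
  {g h u v v' z : FreeGroup X}

/-- The sequence of vertices `H, H z, …, H z ^ k` of the Schreier automaton. -/
def powerPath (H : Subgroup (FreeGroup X)) (k : ℕ) (z : FreeGroup X) :
    Fin (k + 1) → RightCosets H :=
  fun i => cosetVertex H (z ^ (i : ℕ))

theorem mem_preorderSet_rCoset_iff (hk : 1 ≤ k) :
    z ∈ preorderSet (rCoset H u) k ↔
      NearlyInjective (powerPath H k z) ∧ powerPath H k z (Fin.last k) = cosetVertex H u := by
  rw [mem_preorderSet_iff hk, and_comm]
  simp only [mem_rCoset_iff_cosetVertex_eq, powerPath, Fin.val_last]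
  refine and_congr_left fun hu => ?_
  rw [← hu]
  constructor
  · intro hmin i j (hij : (i : ℕ) < j) hz
    have hsplit : z ^ k = z ^ (j : ℕ) * z ^ (k - j) := by
      rw [← pow_add, Nat.add_sub_cancel' j.is_le]
    have hpow : cosetVertex H (z ^ (i + (k - j) : ℕ)) = cosetVertex H (z ^ k) := by
      rw [hsplit, pow_add, cosetVertex_mul_eq_iff]
      exact hz
    have hzero : ¬ 1 ≤ (i : ℕ) + (k - j) := fun hpos => hmin _ hpos (by omega) hpow
    exact ⟨Fin.ext (by rw [Fin.val_zero]; omega), Fin.ext (by rw [Fin.val_last]; omega)⟩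
  · intro hinj j hj hjk hz
    have h0 := (hinj ⟨j, by omega⟩ (Fin.last k) (Fin.lt_def.mpr hjk) hz).1
    exact (Nat.ne_of_gt hj) (congrArg Fin.val h0)

theorem conj_mem_preorbit_iff (hg : move (q 0) g = cosetVertex H 1) :
    g * z * g⁻¹ ∈ (schreier H).preorbit q ↔ ∀ i, move (q i) g = powerPath H k z i := by
  rw [mem_preorbit_schreier_iff]
  constructor
  · intro hz i
    induction i using Fin.induction with
    | zero => simpa [powerPath] using hg
    | succ i ih =>
      rw [← hz i, ← move_mul, inv_mul_cancel_right, move_mul, ih, powerPath, powerPath,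
        move_cosetVertex, Fin.val_succ, pow_succ, Fin.val_castSucc]
  · intro hz i
    rw [move_mul, move_mul, hz, move_eq_iff, inv_inv, hz, powerPath, powerPath, move_cosetVertex,
      Fin.val_castSucc, Fin.val_succ, pow_succ]

theorem mem_conjSet_trail_iff (hv : move (q 0) v = cosetVertex H 1)
    (hv' : move (q (Fin.last k)) v' = cosetVertex H u) :
    z ∈ conjSet ((schreier H).preorbit q) (lCoset v H ∩ lCoset v' (conjSubgroup H u)) ↔
      ∃ g, (∀ i, move (q i) g = powerPath H k z i) ∧
        move (q (Fin.last k)) g = cosetVertex H u := by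
  constructor
  · rintro ⟨w, hw, g, ⟨hgv, hgv'⟩, rfl⟩
    refine ⟨g, (conj_mem_preorbit_iff ((mem_lCoset_iff_move hv).mp hgv)).mp ?_,
      (mem_lCoset_conjSubgroup_iff hv').mp hgv'⟩
    simpa [mul_assoc] using hw
  · rintro ⟨g, hg, hgu⟩
    have hg₀ : move (q 0) g = cosetVertex H 1 := by simpa [powerPath] using hg 0
    exact ⟨g * z * g⁻¹, (conj_mem_preorbit_iff hg₀).mpr hg, g,
      ⟨(mem_lCoset_iff_move hv).mpr hg₀, (mem_lCoset_conjSubgroup_iff hv').mpr hgu⟩, by group⟩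

theorem mem_conjSet_closedTrail_iff (hv : move (q 0) v = cosetVertex H 1) :
    z ∈ conjSet ((schreier H).preorbit q) {v} ↔ ∀ i, move (q i) v = powerPath H k z i := by
  rw [mem_conjSet_singleton_iff, conj_mem_preorbit_iff hv]

theorem exists_cyclic_decomposition (z : FreeGroup X) :
    ∃ C D : List (Letter X), FreeGroup.IsCyclicallyReduced D ∧
      (∀ m, m ≠ 0 → FreeGroup.IsReduced (C ++ (List.replicate m D).flatten ++ FreeGroup.invRev C)) ∧
      (∀ m, z ^ m * FreeGroup.mk C = FreeGroup.mk (C ++ (List.replicate m D).flatten)) ∧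
      (z ≠ 1 → D ≠ []) := by
  classical
  have hred : FreeGroup.IsReduced z.toWord := FreeGroup.isReduced_toWord
  set C := FreeGroup.reduceCyclically.conjugator z.toWord
  set D := FreeGroup.reduceCyclically z.toWord
  have hCD : C ++ D ++ FreeGroup.invRev C = z.toWord :=
    FreeGroup.reduceCyclically.conj_conjugator_reduceCyclically z.toWord
  have hD : FreeGroup.IsCyclicallyReduced D := FreeGroup.reduceCyclically.isCyclicallyReduced hred
  have hz : z = FreeGroup.mk C * FreeGroup.mk D * (FreeGroup.mk C)⁻¹ := by
    rw [FreeGroup.inv_mk, FreeGroup.mul_mk, FreeGroup.mul_mk, hCD, FreeGroup.mk_toWord]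
  refine ⟨C, D, hD, fun m hm => ?_, fun m => ?_, fun hz₁ hD₁ => hz₁ ?_⟩
  · exact FreeGroup.IsReduced.append_flatten_replicate_append hD (hCD.symm ▸ hred) hm
  · rw [← FreeGroup.mul_mk, ← FreeGroup.pow_mk, hz, conj_pow, inv_mul_cancel_right]
  · rw [hz, hD₁, ← FreeGroup.one_eq_mk, mul_one, mul_inv_cancel]

theorem cosetStallings_isWalk {L₁ M L₂ : List (Letter X)}
    (hred : FreeGroup.IsReduced (L₁ ++ M ++ L₂))
    (hu : cosetVertex H (FreeGroup.mk (L₁ ++ M ++ L₂)) = cosetVertex H u) :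
    (cosetStallings H u).IsWalk (cosetVertex H (FreeGroup.mk L₁)) M
      (cosetVertex H (FreeGroup.mk (L₁ ++ M))) := by
  refine InvDigraph.core_isWalk hred ?_ ?_ ?_ <;> rw [schreier_isWalk_iff, move_cosetVertex]
  · rw [one_mul]
  · rw [FreeGroup.mul_mk]
  · rw [FreeGroup.mul_mk, hu]

theorem exists_move_powerPath_mem_cosetStallings (hk : 1 ≤ k)
    (hz : powerPath H k z (Fin.last k) = cosetVertex H u) :
    ∃ c, ∀ i, move (powerPath H k z i) c ∈ (cosetStallings H u).verts := by
  obtain ⟨C, D, -, hred, hpow, -⟩ := exists_cyclic_decomposition z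
  refine ⟨FreeGroup.mk C, fun i => ?_⟩
  have hsplit : C ++ (List.replicate i D).flatten ++ (List.replicate (k - i) D).flatten ++
      FreeGroup.invRev C = C ++ (List.replicate k D).flatten ++ FreeGroup.invRev C := by
    rw [List.append_assoc C, ← List.flatten_append, ← List.replicate_add,
      Nat.add_sub_cancel' i.is_le]
  rw [powerPath, move_cosetVertex, hpow]
  refine (cosetStallings_isWalk (M := (List.replicate (k - i) D).flatten)
    (L₂ := FreeGroup.invRev C) ?_ ?_).left_mem
  · exact hsplit ▸ hred k (by omega)
  · rw [hsplit, ← FreeGroup.mul_mk, ← hpow, ← FreeGroup.inv_mk, mul_inv_cancel_right]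
    exact hz

theorem mem_preorderSet_rCoset_iff_exists_trail (hk : 1 ≤ k) :
    z ∈ preorderSet (rCoset H u) k ↔ ∃ q, (cosetStallings H u).IsTrail q ∧
      ∃ g, (∀ i, move (q i) g = powerPath H k z i) ∧
        move (q (Fin.last k)) g = cosetVertex H u := by
  rw [mem_preorderSet_rCoset_iff hk]
  constructor
  · rintro ⟨hinj, hu⟩
    obtain ⟨c, hc⟩ := exists_move_powerPath_mem_cosetStallings hk hu
    refine ⟨fun i => move (powerPath H k z i) c, (isTrail_iff hk).mpr
      ⟨hc, (nearlyInjective_comp_iff (move_injective c)).mpr hinj⟩, c⁻¹, fun i => ?_, ?_⟩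
    · rw [← move_mul, mul_inv_cancel, move_one]
    · rw [← move_mul, mul_inv_cancel, move_one, hu]
  · rintro ⟨q, hq, g, hg, hu⟩
    have hpath : powerPath H k z = fun i => move (q i) g := funext fun i => (hg i).symm
    exact ⟨hpath ▸ (nearlyInjective_comp_iff (move_injective g)).mpr ((isTrail_iff hk).mp hq).2,
      hpath ▸ hu⟩

theorem pairwiseDisjoint_trail_conjSet
    {v v' : (Fin (k + 1) → RightCosets H) → FreeGroup X}
    (hv : ∀ q, (cosetStallings H u).IsTrail q → move (q 0) (v q) = cosetVertex H 1)
    (hv' : ∀ q, (cosetStallings H u).IsTrail q → move (q (Fin.last k)) (v' q) = cosetVertex H u) :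
    ((fun q => conjSet ((schreier H).preorbit q)
        (lCoset (v q) H ∩ lCoset (v' q) (conjSubgroup H u))) ''
      {q : Fin (k + 1) → RightCosets H | (cosetStallings H u).IsTrail q}).PairwiseDisjoint id := by
  refine pairwiseDisjoint_image_of_eq_of_mem fun q hq q' hq' z hz hz' => ?_
  obtain ⟨g, hg, -⟩ := (mem_conjSet_trail_iff (hv q hq) (hv' q hq)).mp hz
  obtain ⟨g', hg', -⟩ := (mem_conjSet_trail_iff (hv q' hq') (hv' q' hq')).mp hz'
  have htranslate : ∀ i x, move (q i) x = move (q' i) (g' * g⁻¹ * x) := fun i x => by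
    rw [move_mul, move_mul, hg', ← hg, ← move_mul _ g, mul_inv_cancel, move_one]
  ext y
  rw [mem_conjSet_trail_iff (hv q hq) (hv' q hq), mem_conjSet_trail_iff (hv q' hq') (hv' q' hq')]
  simp only [htranslate]
  exact ⟨fun ⟨x, hx⟩ => ⟨_, hx⟩,
    fun ⟨x, hx⟩ => ⟨(g' * g⁻¹)⁻¹ * x, by simpa only [mul_inv_cancel_left] using hx⟩⟩

theorem preorderSet_eq_iUnion_trails (hk : 1 ≤ k)
    {v v' : (Fin (k + 1) → RightCosets H) → FreeGroup X}
    (hv : ∀ q, (cosetStallings H u).IsTrail q → move (q 0) (v q) = cosetVertex H 1)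
    (hv' : ∀ q, (cosetStallings H u).IsTrail q → move (q (Fin.last k)) (v' q) = cosetVertex H u) :
    preorderSet (rCoset H u) k =
      ⋃ q ∈ {q : Fin (k + 1) → RightCosets H | (cosetStallings H u).IsTrail q},
        conjSet ((schreier H).preorbit q)
          (lCoset (v q) H ∩ lCoset (v' q) (conjSubgroup H u)) := by
  ext z
  simp only [mem_preorderSet_rCoset_iff_exists_trail hk, Set.mem_iUnion, Set.mem_ofPred_eq,
    exists_prop]
  exact exists_congr fun q => and_congr_right fun hq =>
    (mem_conjSet_trail_iff (hv q hq) (hv' q hq)).symm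

end Trails

section ClosedTrails

variable {X : Type*} {H : Subgroup (FreeGroup X)} {k : ℕ} {z : FreeGroup X}

theorem exists_move_powerPath_mem_restrictedStallings_of_ne_one (hk : 1 ≤ k) (hz : z ^ k ∈ H)
    (hz₁ : z ≠ 1) : ∃ c, ∀ i, move (powerPath H k z i) c ∈ (restrictedStallings H).verts := by
  obtain ⟨C, D, hD, hred, hpow, hne⟩ := exists_cyclic_decomposition z
  refine ⟨FreeGroup.mk C, fun i => ?_⟩
  have hDk : (List.replicate k D).flatten ≠ [] := by simpa using ⟨by omega, hne hz₁⟩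
  have hsplit : C ++ (List.replicate i D).flatten ++ (List.replicate k D).flatten ++
      ((List.replicate (k - i) D).flatten ++ FreeGroup.invRev C) =
      C ++ (List.replicate (k + k) D).flatten ++ FreeGroup.invRev C := by
    rw [show k + k = i + k + (k - i) by omega]
    simp only [List.replicate_add, List.flatten_append, List.append_assoc]
  have hwalk := cosetStallings_isWalk (H := H) (u := 1) (M := (List.replicate k D).flatten)
    (hsplit ▸ hred (k + k) (by omega)) (by
      rw [hsplit, ← FreeGroup.mul_mk, ← hpow, ← FreeGroup.inv_mk, mul_inv_cancel_right,
        cosetVertex_eq_one_iff, pow_add]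
      exact H.mul_mem hz hz)
  have hclosed : cosetVertex H (z ^ ((i : ℕ) + k) * FreeGroup.mk C) =
      cosetVertex H (z ^ (i : ℕ) * FreeGroup.mk C) := by
    rw [cosetVertex_mul_eq_iff, cosetVertex_eq_iff, add_comm (i : ℕ) k, pow_add]
    simpa using H.inv_mem hz
  rw [List.append_assoc, ← List.flatten_append, ← List.replicate_add, ← hpow, ← hpow,
    hclosed] at hwalk
  refine ⟨hwalk.left_mem, ?_⟩
  rintro ⟨T, a, hT, hx, hxa⟩
  exact hxa (hT.eq_root_of_isWalk hx (hD.flatten_replicate k) hDk hwalk)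

theorem cosetStallings_bot_verts_subset :
    (cosetStallings (⊥ : Subgroup (FreeGroup X)) 1).verts ⊆ {cosetVertex ⊥ 1} := by
  classical
  rintro v ⟨-, L₁, L₂, hred, h₁, h₂⟩
  rw [schreier_isWalk_iff] at h₁ h₂
  have hone : FreeGroup.mk (L₁ ++ L₂) = 1 := by
    rw [← Subgroup.mem_bot, ← cosetVertex_eq_one_iff, ← h₂, ← h₁, ← move_mul, FreeGroup.mul_mk,
      move_cosetVertex, one_mul]
  have hnil : L₁ ++ L₂ = [] := by
    rw [← hred.reduce_eq, ← FreeGroup.toWord_mk, hone, FreeGroup.toWord_one]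
  rw [Set.mem_singleton_iff, ← h₁, (List.append_eq_nil_iff.mp hnil).1, ← FreeGroup.one_eq_mk,
    move_one]

theorem finite_setOf_isClosedTrail_restrictedStallings (hH : H.FG) :
    {q : Fin (k + 1) → RightCosets H | (restrictedStallings H).IsClosedTrail q}.Finite :=
  (finite_setOf_isTrail ((finite_cosetStallings_verts hH 1).subset Set.inter_subset_left)).subset
    fun _ hq => Or.inr hq

theorem restrictedStallings_verts_nonempty (H : Subgroup (FreeGroup X)) :
    (restrictedStallings H).verts.Nonempty := by
  obtain rfl | ⟨z, hz, hz₁⟩ := H.bot_or_exists_ne_one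
  · have hbase : cosetVertex ⊥ 1 ∈ (cosetStallings (⊥ : Subgroup (FreeGroup X)) 1).verts :=
      (cosetStallings_isWalk (L₁ := []) (M := []) (L₂ := []) (by simp) rfl).left_mem
    refine ⟨cosetVertex ⊥ 1, hbase, ?_⟩
    rintro ⟨T, a, hT, -, hne⟩
    exact hne (cosetStallings_bot_verts_subset (hT.1 hT.2.1)).symm
  · obtain ⟨c, hc⟩ := exists_move_powerPath_mem_restrictedStallings_of_ne_one le_rfl
      ((pow_one z).symm ▸ hz) hz₁
    exact ⟨_, hc 0⟩

theorem exists_move_powerPath_mem_restrictedStallings (hk : 1 ≤ k) (hz : z ^ k ∈ H) :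
    ∃ c, ∀ i, move (powerPath H k z i) c ∈ (restrictedStallings H).verts := by
  by_cases hz₁ : z = 1
  · obtain ⟨p, hp⟩ := restrictedStallings_verts_nonempty H
    obtain ⟨g, rfl⟩ := exists_cosetVertex p
    exact ⟨g, fun i => by simpa [powerPath, hz₁] using hp⟩
  · exact exists_move_powerPath_mem_restrictedStallings_of_ne_one hk hz hz₁

theorem powerPath_conj {h : FreeGroup X} (hh : h ∈ H) (i : Fin (k + 1)) :
    powerPath H k (h⁻¹ * z * h) i = move (powerPath H k z i) h := by
  have hpow : (h⁻¹ * z * h) ^ (i : ℕ) = h⁻¹ * (z ^ (i : ℕ) * h) := by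
    simpa [mul_assoc] using conj_pow (a := h⁻¹) (b := z) (i := i)
  rw [powerPath, powerPath, hpow, move_cosetVertex, cosetVertex_eq_iff]
  simpa [mul_assoc] using hh

theorem pairwiseDisjoint_closedTrail_conjSet
    {v : (Fin (k + 1) → RightCosets H) → FreeGroup X}
    (hv : ∀ q, (restrictedStallings H).IsClosedTrail q → move (q 0) (v q) = cosetVertex H 1) :
    ((fun q => conjSet ((schreier H).preorbit q) {v q}) ''
      {q : Fin (k + 1) → RightCosets H |
        (restrictedStallings H).IsClosedTrail q}).PairwiseDisjoint id := by
  refine pairwiseDisjoint_image_of_eq_of_mem fun q hq q' hq' z hz hz' => Set.ext fun y => ?_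
  rw [mem_conjSet_closedTrail_iff (hv q hq)] at hz
  rw [mem_conjSet_closedTrail_iff (hv q' hq')] at hz'
  rw [mem_conjSet_closedTrail_iff (hv q hq), mem_conjSet_closedTrail_iff (hv q' hq')]
  simp only [hz, hz']

theorem exists_closedTrail_of_mem_preorderSet (hk : 1 ≤ k)
    (hz : z ∈ preorderSet (H : Set (FreeGroup X)) k) :
    ∃ c, (restrictedStallings H).IsClosedTrail fun i => move (powerPath H k z i) c := by
  rw [← rCoset_one, mem_preorderSet_rCoset_iff hk] at hz
  obtain ⟨c, hc⟩ :=
    exists_move_powerPath_mem_restrictedStallings hk (cosetVertex_eq_one_iff.mp hz.2)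
  refine ⟨c, (isClosedTrail_iff hk).mpr
    ⟨hc, (nearlyInjective_comp_iff (move_injective c)).mpr hz.1, ?_⟩⟩
  rw [hz.2, powerPath, Fin.val_zero, pow_zero]

theorem mem_preorderSet_of_closedTrail (hk : 1 ≤ k) {q : Fin (k + 1) → RightCosets H}
    (hq : (restrictedStallings H).IsClosedTrail q) {g : FreeGroup X}
    (hg : ∀ i, move (q i) g = powerPath H k z i) : z ∈ preorderSet (H : Set (FreeGroup X)) k := by
  obtain ⟨-, hinj, hlast⟩ := (isClosedTrail_iff hk).mp hq
  have hpath : powerPath H k z = fun i => move (q i) g := funext fun i => (hg i).symm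
  rw [← rCoset_one, mem_preorderSet_rCoset_iff hk]
  refine ⟨hpath ▸ (nearlyInjective_comp_iff (move_injective g)).mpr hinj, ?_⟩
  rw [← hg, hlast, hg, powerPath, Fin.val_zero, pow_zero]

theorem preorderSet_eq_conjSet_iUnion_closedTrails (hk : 1 ≤ k)
    {v : (Fin (k + 1) → RightCosets H) → FreeGroup X}
    (hv : ∀ q, (restrictedStallings H).IsClosedTrail q → move (q 0) (v q) = cosetVertex H 1) :
    preorderSet (H : Set (FreeGroup X)) k =
      conjSet
        (⋃ q ∈ {q : Fin (k + 1) → RightCosets H | (restrictedStallings H).IsClosedTrail q},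
          conjSet ((schreier H).preorbit q) {v q})
        (H : Set (FreeGroup X)) := by
  ext z
  constructor
  · intro hz
    obtain ⟨c, hc⟩ := exists_closedTrail_of_mem_preorderSet hk hz
    set q : Fin (k + 1) → RightCosets H := fun i => move (powerPath H k z i) c
    have hmem : c * v q ∈ H := by
      simpa [q, powerPath, cosetVertex_eq_one_iff] using hv q hc
    refine ⟨_, Set.mem_biUnion hc ((mem_conjSet_closedTrail_iff (hv q hc)).mpr fun i =>
      ((powerPath_conj hmem i).trans (move_mul _ _ _)).symm), (c * v q)⁻¹, H.inv_mem hmem, ?_⟩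
    group
  · rintro ⟨y, hy, h, hh, rfl⟩
    obtain ⟨q, hq, hyq⟩ := Set.mem_iUnion₂.mp hy
    rw [mem_conjSet_closedTrail_iff (hv q hq)] at hyq
    exact mem_preorderSet_of_closedTrail hk hq (g := v q * h) fun i => by
      rw [move_mul, hyq, powerPath_conj hh]

end ClosedTrails

/-! ### Primitive recursive list operations -/

/-- The list of all lists of length `n` with entries in `l`. -/
def listsOfLength {α : Type*} (l : List α) (n : ℕ) : List (List α) :=
  n.rec [[]] fun _ ls => ls.flatMap fun s => l.map fun a => a :: s

theorem mem_listsOfLength {α : Type*} {l s : List α} {n : ℕ} :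
    s ∈ listsOfLength l n ↔ s.length = n ∧ ∀ a ∈ s, a ∈ l := by
  induction n generalizing s with
  | zero => cases s <;> simp [listsOfLength]
  | succ n ih =>
    have hsucc : listsOfLength l (n + 1) =
        (listsOfLength l n).flatMap fun s => l.map fun a => a :: s := rfl
    cases s with
    | nil => simp [hsucc]
    | cons a s => simp [hsucc, ih]; tauto

theorem subset_pwFilter_append {α : Type*} {R : α → α → Prop} [DecidableRel R] {l m : List α}
    (hm : m.Pairwise R) : m ⊆ (l ++ m).pwFilter R := by
  induction l with
  | nil => rw [List.nil_append, List.pwFilter_eq_self.mpr hm]; exact List.Subset.refl m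
  | cons a l ih =>
    rw [List.cons_append]
    by_cases ha : ∀ b ∈ (l ++ m).pwFilter R, R a b
    · rw [List.pwFilter_cons_of_pos ha]
      exact List.subset_cons_of_subset a ih
    · rwa [List.pwFilter_cons_of_neg ha]

theorem exists_mem_pwFilter {β : Type*} {R : β → β → Prop} [DecidableRel R] {l : List β} {a : β}
    (hR : ∀ a b c, R a c → R a b ∨ R b c) (ha : a ∈ l) (haa : ¬ R a a) :
    ∃ b ∈ l.pwFilter R, ¬ R a b := by
  by_contra! h
  exact haa ((List.forall_mem_pwFilter (fun {a b c} => hR a b c) a l).mp h a ha)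

section PrimitiveRecursion

variable {α β : Type*} [Primcodable α] [Primcodable β] {p q : α → Prop} {f : α → List β}
  {R : α → β → Prop}

theorem primrec_natPow {f g : α → ℕ} (hf : Primrec f) (hg : Primrec g) :
    Primrec fun a => f a ^ g a :=
  (Primrec₂.unpaired'.mp Nat.Primrec.pow).comp hf hg

theorem primrecPred_imp (hp : PrimrecPred p) (hq : PrimrecPred q) :
    PrimrecPred fun a => p a → q a :=
  (hp.not.or hq).of_eq fun _ => imp_iff_not_or.symm

theorem primrecPred_iff (hp : PrimrecPred p) (hq : PrimrecPred q) :
    PrimrecPred fun a => (p a ↔ q a) :=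
  ((primrecPred_imp hp hq).and (primrecPred_imp hq hp)).of_eq fun _ =>
    iff_iff_implies_and_implies.symm

theorem primrecPred_forall_mem (hf : Primrec f) (hR : PrimrecRel R) :
    PrimrecPred fun a => ∀ b ∈ f a, R a b :=
  hR.swap.forall_mem_list.comp hf .id

theorem primrecPred_forall_lt {f : α → ℕ} {R : α → ℕ → Prop} (hf : Primrec f)
    (hR : PrimrecRel R) : PrimrecPred fun a => ∀ n < f a, R a n :=
  (primrecPred_forall_mem (Primrec.list_range.comp hf) hR).of_eq fun _ => by
    simp only [List.mem_range]

theorem primrec_filter [DecidableRel R] (hf : Primrec f) (hR : PrimrecRel R) :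
    Primrec fun a => (f a).filter fun b => R a b :=
  hR.swap.listFilter.comp hf .id

theorem primrec_list_product {γ : Type*} [Primcodable γ] {g : α → List γ} (hf : Primrec f)
    (hg : Primrec g) : Primrec fun a => f a ×ˢ g a :=
  Primrec.list_flatMap hf (Primrec.list_map (hg.comp .fst) ((Primrec.snd.comp .fst).pair .snd))

theorem primrec_inits : Primrec (List.inits : List α → List (List α)) := by
  refine (Primrec.list_foldr (g := fun _ => [[]])
    (h := fun _ p => [] :: p.2.map (fun l => p.1 :: l)) Primrec.id (Primrec.const _)
    (Primrec.list_cons.comp (Primrec.const []) (Primrec.list_map (Primrec.snd.comp Primrec.snd)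
      (Primrec.list_cons.comp (Primrec.fst.comp (Primrec.snd.comp Primrec.fst))
        Primrec.snd)))).of_eq fun l => ?_
  induction l with
  | nil => rfl
  | cons a l ih =>
    rw [List.inits_cons, ← ih]
    rfl

theorem primrec_pwFilter {R : α → β → β → Prop} [∀ a, DecidableRel (R a)] (hf : Primrec f)
    (hR : PrimrecPred fun x : α × β × β => R x.1 x.2.1 x.2.2) :
    Primrec fun a => (f a).pwFilter (R a) := by
  classical
  refine (Primrec.list_foldr (g := fun _ => [])
    (h := fun a p => if ∀ c ∈ p.2, R a p.1 c then p.1 :: p.2 else p.2) hf (Primrec.const _)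
    (Primrec.ite (primrecPred_forall_mem (Primrec.snd.comp Primrec.snd) (hR.comp
        ((Primrec.fst.comp Primrec.fst).pair
          ((Primrec.fst.comp (Primrec.snd.comp Primrec.fst)).pair Primrec.snd))))
      (Primrec.list_cons.comp (Primrec.fst.comp Primrec.snd) (Primrec.snd.comp Primrec.snd))
      (Primrec.snd.comp Primrec.snd))).of_eq fun a => ?_
  unfold List.pwFilter
  congr!

theorem primrec_listsOfLength : Primrec₂ (listsOfLength : List α → ℕ → List (List α)) := by
  refine Primrec.nat_rec (f := fun _ => [[]])
    (g := fun (l : List α) (p : ℕ × List (List α)) => p.2.flatMap fun s => l.map (· :: s))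
    (Primrec.const _) (Primrec.list_flatMap (Primrec.snd.comp Primrec.snd) ?_)
  exact Primrec.list_map (Primrec.fst.comp Primrec.fst)
    (Primrec.list_cons.comp Primrec.snd (Primrec.snd.comp Primrec.fst))

end PrimitiveRecursion

/-! ### The membership problem -/

section Membership

variable {X : Type*} {S : List (List (Letter X))} {w : List (Letter X)} {x : X}
  {f : List (Letter X) → ℕ}

/-- Reading the last letter of `p` or of `q` backwards or forwards, respectively, gives an arc
`p → q` with label `x` in the tree of all words. -/
def IsPrefixArc (x : X) (p q : List (Letter X)) : Prop :=
  q = p ++ [(x, true)] ∨ p = q ++ [(x, false)]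

/-- The vertex labelling `f` of the tree of all prefixes of `w` and of the words of `S` is folded
if the digraph obtained by identifying vertices with the same label is deterministic and
codeterministic. -/
def IsFolded (S : List (List (Letter X))) (w : List (Letter X)) (f : List (Letter X) → ℕ) : Prop :=
  ∀ x ∈ letterList S w, ∀ p ∈ prefixList S w, ∀ p' ∈ prefixList S w, IsPrefixArc x p p' →
    ∀ q ∈ prefixList S w, ∀ q' ∈ prefixList S w, IsPrefixArc x q q' → (f p = f q ↔ f p' = f q')

theorem mk_eq_of_isPrefixArc {p q : List (Letter X)} (h : IsPrefixArc x p q) :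
    FreeGroup.mk q = FreeGroup.mk p * FreeGroup.mk [(x, true)] := by
  obtain rfl | rfl := h
  · rw [FreeGroup.mul_mk]
  · have hinv : FreeGroup.mk [(x, false)] = (FreeGroup.mk [(x, true)])⁻¹ := rfl
    rw [← FreeGroup.mul_mk, hinv, inv_mul_cancel_right]

theorem IsFolded.exists_perm (hf : IsFolded S w f) (hx : x ∈ letterList S w) :
    ∃ σ : Equiv.Perm ℕ, ∀ p ∈ prefixList S w, ∀ q ∈ prefixList S w, IsPrefixArc x p q →
      σ (f p) = f q := by
  let arcs : Set (ℕ × ℕ) := {e | ∃ p ∈ prefixList S w, ∃ q ∈ prefixList S w,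
    IsPrefixArc x p q ∧ e = (f p, f q)}
  have hfinite : arcs.Finite := by
    refine (((prefixList S w).finite_toSet.image f).prod
      ((prefixList S w).finite_toSet.image f)).subset ?_
    rintro _ ⟨p, hp, q, hq, -, rfl⟩
    exact ⟨⟨p, hp, rfl⟩, ⟨q, hq, rfl⟩⟩
  have : Finite arcs := hfinite
  have hiff : ∀ e e' : arcs, e.1.1 = e'.1.1 ↔ e.1.2 = e'.1.2 := by
    rintro ⟨_, p, hp, q, hq, hpq, rfl⟩ ⟨_, p', hp', q', hq', hpq', rfl⟩
    exact hf x hx p hp q hq hpq p' hp' q' hq' hpq'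
  obtain ⟨σ, hσ⟩ := Equiv.Perm.exists_extending_pair (fun e : arcs => e.1.1) (fun e => e.1.2)
    (fun e e' h => Subtype.ext (Prod.ext h ((hiff e e').mp h)))
    (fun e e' h => Subtype.ext (Prod.ext ((hiff e e').mpr h) h))
  exact ⟨σ, fun p hp q hq hpq => hσ ⟨_, p, hp, q, hq, hpq, rfl⟩⟩

/-- Marshall Hall's argument: the partial injections given by the letters extend to permutations,
hence to an action of the free group in which every word of `S` fixes the label of `[]`. -/
theorem IsFolded.exists_hom (hf : IsFolded S w f) :
    ∃ φ : FreeGroup X →* Equiv.Perm ℕ, ∀ p ∈ prefixList S w, φ (FreeGroup.mk p) (f p) = f [] := by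
  have hperm : ∀ x, ∃ σ : Equiv.Perm ℕ, x ∈ letterList S w → ∀ p ∈ prefixList S w,
      ∀ q ∈ prefixList S w, IsPrefixArc x p q → σ (f p) = f q := fun x => by
    by_cases hx : x ∈ letterList S w
    · exact (hf.exists_perm hx).imp fun σ hσ _ => hσ
    · exact ⟨1, fun h => absurd h hx⟩
  choose σ hσ using hperm
  refine ⟨FreeGroup.lift fun x => (σ x)⁻¹, fun p hp => ?_⟩
  induction p using List.reverseRecOn with
  | nil => rw [← FreeGroup.one_eq_mk, map_one, Equiv.Perm.one_apply]
  | append_singleton p a ih =>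
    have hp' := mem_prefixList_of_prefix hp (List.prefix_append p [a])
    rw [← FreeGroup.mul_mk, map_mul, Equiv.Perm.mul_apply]
    convert ih hp' using 2
    obtain ⟨x, b⟩ := a
    have hx : x ∈ letterList S w := fst_mem_letterList hp (a := (x, b)) (by simp)
    cases b with
    | true => simp [← hσ x hx p hp' _ hp (Or.inl rfl)]
    | false => simp [hσ x hx _ hp p hp' (Or.inr rfl)]

theorem IsFolded.eq_of_mem_spanWords (hf : IsFolded S w f) (hS : ∀ s ∈ S, f s = f [])
    (hw : FreeGroup.mk w ∈ spanWords S) : f w = f [] := by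
  obtain ⟨φ, hφ⟩ := hf.exists_hom
  have hstab : spanWords S ≤ (MulAction.stabilizer (Equiv.Perm ℕ) (f [])).comap φ := by
    refine (Subgroup.closure_le _).mpr ?_
    rintro _ ⟨s, hs, rfl⟩
    have := hφ s (mem_prefixList_of_mem hs)
    rwa [hS s hs] at this
  exact (φ (FreeGroup.mk w)).injective ((hφ w self_mem_prefixList).trans (hstab hw).symm)

open Classical in
/-- The label of the prefix `p` if the labels of the list of all prefixes are listed in `l`. -/
noncomputable def prefixLabel (S : List (List (Letter X))) (w : List (Letter X)) (l : List ℕ)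
    (p : List (Letter X)) : ℕ :=
  l.getD ((prefixList S w).idxOf p) 0

theorem prefixLabel_map {p : List (Letter X)} (hp : p ∈ prefixList S w) :
    prefixLabel S w ((prefixList S w).map f) p = f p := by
  classical
  rw [prefixLabel, List.getD_eq_getElem _ _ (by simpa using List.idxOf_lt_length_of_mem hp),
    List.getElem_map]
  congr 1
  convert List.getElem_idxOf (List.idxOf_lt_length_of_mem hp)

theorem exists_separating_label (S : List (List (Letter X))) (w : List (Letter X)) :
    ∃ f : List (Letter X) → ℕ, ∀ p ∈ prefixList S w, f p < (prefixList S w).length ∧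
      ∀ q ∈ prefixList S w, f p = f q ↔
        cosetVertex (spanWords S) (.mk p) = cosetVertex (spanWords S) (.mk q) := by
  classical
  let c (p : List (Letter X)) : RightCosets (spanWords S) := cosetVertex _ (FreeGroup.mk p)
  let f (p : List (Letter X)) : ℕ := (prefixList S w).findIdx fun q => c q = c p
  have hlt : ∀ p ∈ prefixList S w, f p < (prefixList S w).length := fun p hp =>
    List.findIdx_lt_length_of_exists ⟨p, hp, decide_eq_true rfl⟩
  have hc : ∀ p (hp : p ∈ prefixList S w), c ((prefixList S w)[f p]'(hlt p hp)) = c p :=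
    fun p hp => of_decide_eq_true (List.findIdx_getElem (w := hlt p hp))
  refine ⟨f, fun p hp => ⟨hlt p hp, fun q hq => ⟨fun h => ?_, fun h => ?_⟩⟩⟩
  · change c p = c q
    rw [← hc p hp, ← hc q hq]
    simp only [h]
  · change (prefixList S w).findIdx (fun r => c r = c p) = _
    rw [show c p = c q from h]

theorem mem_spanWords_iff_forall_label : FreeGroup.mk w ∈ spanWords S ↔
    ∀ l ∈ listsOfLength (List.range (prefixList S w).length) (prefixList S w).length,
      IsFolded S w (prefixLabel S w l) →
        (∀ s ∈ S, prefixLabel S w l s = prefixLabel S w l []) →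
          prefixLabel S w l w = prefixLabel S w l [] := by
  refine ⟨fun hw l _ hl hS => hl.eq_of_mem_spanWords hS hw, fun h => ?_⟩
  obtain ⟨f, hf⟩ := exists_separating_label S w
  have hlist : (prefixList S w).map f ∈
      listsOfLength (List.range (prefixList S w).length) (prefixList S w).length := by
    refine mem_listsOfLength.mpr ⟨List.length_map _, List.forall_mem_map.mpr fun p hp => ?_⟩
    exact List.mem_range.mpr (hf p hp).1
  have hlabel : ∀ {p q}, p ∈ prefixList S w → q ∈ prefixList S w →
      (prefixLabel S w ((prefixList S w).map f) p = prefixLabel S w ((prefixList S w).map f) q ↔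
        cosetVertex (spanWords S) (FreeGroup.mk p) = cosetVertex (spanWords S) (FreeGroup.mk q)) :=
    fun hp hq => by rw [prefixLabel_map hp, prefixLabel_map hq, (hf _ hp).2 _ hq]
  rw [← cosetVertex_eq_one_iff]
  refine (hlabel self_mem_prefixList nil_mem_prefixList).mp (h _ hlist ?_ fun s hs => ?_)
  · intro x _ p hp p' hp' hpp' q hq q' hq' hqq'
    rw [hlabel hp hq, hlabel hp' hq', mk_eq_of_isPrefixArc hpp', mk_eq_of_isPrefixArc hqq',
      cosetVertex_mul_eq_iff]
  · exact (hlabel (mem_prefixList_of_mem hs) nil_mem_prefixList).mpr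
      (cosetVertex_eq_one_iff.mpr (Subgroup.subset_closure ⟨s, hs, rfl⟩))

variable [Primcodable X]

theorem primrec_prefixList : Primrec₂ (prefixList (X := X)) :=
  Primrec.list_flatMap (Primrec.list_cons.comp Primrec.snd Primrec.fst)
    (primrec_inits.comp Primrec.snd)

theorem primrec_letterList : Primrec₂ (letterList (X := X)) :=
  Primrec.list_map (Primrec.list_flatten.comp (Primrec.list_cons.comp Primrec.snd Primrec.fst))
    (Primrec.fst.comp Primrec.snd)

theorem primrec_prefixLabel {α : Type*} [Primcodable α] {S : α → List (List (Letter X))}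
    {w p : α → List (Letter X)} {l : α → List ℕ} (hS : Primrec S) (hw : Primrec w)
    (hl : Primrec l) (hp : Primrec p) : Primrec fun a => prefixLabel (S a) (w a) (l a) (p a) := by
  classical
  exact ((Primrec.list_getD 0).comp hl
    (Primrec.list_idxOf.comp hp (primrec_prefixList.comp hS hw))).of_eq fun a => by
      rw [prefixLabel]; congr!

theorem primrecPred_isPrefixArc {α : Type*} [Primcodable α] {x : α → X}
    {p q : α → List (Letter X)} (hx : Primrec x) (hp : Primrec p) (hq : Primrec q) :
    PrimrecPred fun a => IsPrefixArc (x a) (p a) (q a) :=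
  (Primrec.eq.comp hq (Primrec.list_concat.comp hp (hx.pair (.const true)))).or
    (Primrec.eq.comp hp (Primrec.list_concat.comp hq (hx.pair (.const false))))

theorem primrecPred_isFolded {α : Type*} [Primcodable α] {S : α → List (List (Letter X))}
    {w : α → List (Letter X)} {l : α → List ℕ} (hS : Primrec S) (hw : Primrec w)
    (hl : Primrec l) :
    PrimrecPred fun a => IsFolded (S a) (w a) (prefixLabel (S a) (w a) (l a)) := by
  have hV : Primrec fun a => prefixList (S a) (w a) := primrec_prefixList.comp hS hw
  have hx : Primrec fun y : α × X => y.2 := .snd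
  refine primrecPred_forall_mem (primrec_letterList.comp hS hw) (primrecPred_forall_mem
    (hV.comp .fst) (primrecPred_forall_mem (hV.comp (.comp .fst .fst)) (primrecPred_imp
      (primrecPred_isPrefixArc (hx.comp (.comp .fst .fst)) (.comp .snd .fst) .snd)
      (primrecPred_forall_mem (hV.comp (.comp .fst (.comp .fst .fst))) (primrecPred_forall_mem
        (hV.comp (.comp .fst (.comp .fst (.comp .fst .fst)))) (primrecPred_imp
          (primrecPred_isPrefixArc (hx.comp (.comp .fst (.comp .fst (.comp .fst .fst))))
            (.comp .snd .fst) .snd) ?_))))))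
  have ha : Primrec fun y : ((((α × X) × List (Letter X)) × List (Letter X)) ×
      List (Letter X)) × List (Letter X) => y.1.1.1.1.1 :=
    .comp .fst (.comp .fst (.comp .fst (.comp .fst .fst)))
  have hlabel := fun {p} hp => primrec_prefixLabel (p := p) (hS.comp ha) (hw.comp ha)
    (hl.comp ha) hp
  exact primrecPred_iff
    (Primrec.eq.comp (hlabel (.comp .snd (.comp .fst (.comp .fst .fst))))
      (hlabel (.comp .snd .fst)))
    (Primrec.eq.comp (hlabel (.comp .snd (.comp .fst .fst))) (hlabel .snd))

theorem primrecPred_mem_spanWords {α : Type*} [Primcodable α] {S : α → List (List (Letter X))}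
    {w : α → List (Letter X)} (hS : Primrec S) (hw : Primrec w) :
    PrimrecPred fun a => FreeGroup.mk (w a) ∈ spanWords (S a) := by
  have hS' := hS.comp (Primrec.fst (β := List ℕ))
  have hw' := hw.comp (Primrec.fst (β := List ℕ))
  have hlength : Primrec fun a => (prefixList (S a) (w a)).length :=
    Primrec.list_length.comp (primrec_prefixList.comp hS hw)
  refine (primrecPred_forall_mem (primrec_listsOfLength.comp (Primrec.list_range.comp hlength)
    hlength) ?_).of_eq fun _ => mem_spanWords_iff_forall_label.symm
  refine primrecPred_imp (primrecPred_isFolded hS' hw' Primrec.snd) (primrecPred_imp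
    (primrecPred_forall_mem hS' ?_) ?_)
  · exact Primrec.eq.comp (primrec_prefixLabel (hS'.comp .fst) (hw'.comp .fst)
        (Primrec.snd.comp .fst) .snd)
      (primrec_prefixLabel (hS'.comp .fst) (hw'.comp .fst) (Primrec.snd.comp .fst) (.const []))
  · exact Primrec.eq.comp (primrec_prefixLabel hS' hw' .snd hw')
      (primrec_prefixLabel hS' hw' .snd (.const []))

end Membership

/-! ### Representatives of the orbit cosets -/

section OrbitCosets

variable {X : Type*} {H : Subgroup (FreeGroup X)} {g h u w z : FreeGroup X} {k : ℕ}

theorem mem_orbitCoset_iff : g ∈ orbitCoset H k w ↔ powerPath H k g = powerPath H k w := by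
  have hmove : g ∈ orbitCoset H k w ↔
      ∀ i : Fin k, move (powerPath H k w i.castSucc) g = powerPath H k w i.succ := by
    rw [orbitCoset, mem_rCoset_iff, Subgroup.mem_iInf]
    refine forall_congr' fun i => ?_
    rw [mem_conjSubgroup_iff_cosetVertex_eq, ← mul_assoc, powerPath, powerPath, Fin.val_succ,
      pow_succ, move_cosetVertex, Fin.val_castSucc, ← cosetVertex_mul_eq_iff (w := w),
      inv_mul_cancel_right]
  have hone : move (powerPath H k w 0) 1 = cosetVertex H 1 := by simp [powerPath]
  rw [hmove, ← mem_preorbit_schreier_iff, funext_iff]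
  simpa [eq_comm] using conj_mem_preorbit_iff (z := g) hone

theorem mem_preorderSet_iff_of_mem_orbitCoset (hk : 1 ≤ k) (hg : g ∈ orbitCoset H k w) :
    g ∈ preorderSet (rCoset H u) k ↔ w ∈ preorderSet (rCoset H u) k := by
  rw [mem_preorderSet_rCoset_iff hk, mem_preorderSet_rCoset_iff hk, mem_orbitCoset_iff.mp hg]

theorem conj_mem_preorderSet_iff (hk : 1 ≤ k) (hh : h ∈ H ⊓ conjSubgroup H u) :
    h⁻¹ * z * h ∈ preorderSet (rCoset H u) k ↔ z ∈ preorderSet (rCoset H u) k := by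
  have hu : move (cosetVertex H u) h = cosetVertex H u :=
    mem_conjSubgroup_iff_cosetVertex_eq.mp hh.2
  rw [mem_preorderSet_rCoset_iff hk, mem_preorderSet_rCoset_iff hk,
    funext (powerPath_conj (k := k) (z := z) hh.1), nearlyInjective_comp_iff (move_injective h),
    move_eq_iff, ← move_eq_iff.mp hu]

theorem conjSet_orbitCoset_subset (hk : 1 ≤ k) (hw : w ∈ preorderSet (rCoset H u) k) :
    conjSet (orbitCoset H k w) ↑(H ⊓ conjSubgroup H u) ⊆ preorderSet (rCoset H u) k := by
  rintro _ ⟨g, hg, h, hh, rfl⟩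
  exact (conj_mem_preorderSet_iff hk hh).mpr ((mem_preorderSet_iff_of_mem_orbitCoset hk hg).mpr hw)

theorem disjoint_orbitCoset (h : g ∉ orbitCoset H k w) :
    Disjoint (orbitCoset H k g) (orbitCoset H k w) :=
  Set.disjoint_left.mpr fun _ hg hw => h (mem_orbitCoset_iff.mpr
    ((mem_orbitCoset_iff.mp hg).symm.trans (mem_orbitCoset_iff.mp hw)))

variable {S : List (List (Letter X))} {u : List (Letter X)}

theorem exists_short_words_powerPath_eq_conj (hk : 1 ≤ k)
    (hz : powerPath (spanWords S) k z (Fin.last k) = cosetVertex (spanWords S) (.mk u)) :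
    ∃ D E : List (Letter X), D.length ≤ (prefixList S u).length ^ k ∧
      E.length ≤ (prefixList S u).length ^ 2 ∧ (∀ a ∈ D, a.1 ∈ letterList S u) ∧
      (∀ a ∈ E, a.1 ∈ letterList S u) ∧
      ∃ h ∈ spanWords S ⊓ conjSubgroup (spanWords S) (.mk u),
        powerPath (spanWords S) k ((.mk E)⁻¹ * .mk D * .mk E) =
          powerPath (spanWords S) k (h⁻¹ * z * h) := by
  have : NeZero k := ⟨by omega⟩
  obtain ⟨c, hc⟩ := exists_move_powerPath_mem_cosetStallings hk hz
  replace hc := fun i => cosetStallings_verts_subset (hc i)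
  set q : Fin (k + 1) → RightCosets (spanWords S) := fun i => move (powerPath _ k z i) c with hq
  have hqc : ∀ i, move (q i) c⁻¹ = powerPath (spanWords S) k z i := fun i =>
    (move_eq_iff.mp rfl).symm
  have hqz : c⁻¹ * z * c ∈ (schreier (spanWords S)).preorbit q := by
    simpa using (conj_mem_preorbit_iff (by simp [hqc, powerPath])).mpr hqc
  obtain ⟨D, hDlength, hDletter, hD⟩ := exists_short_word (v := fun i : Fin k => q i.castSucc)
    (fun i => hc _) (fun i => hc _) (mem_preorbit_schreier_iff.mp hqz)
  obtain ⟨E, hElength, hEletter, hE⟩ := exists_short_word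
    (v := fun b : Bool => q (bif b then 0 else Fin.last k))
    (v' := fun b => cosetVertex (spanWords S) (bif b then 1 else .mk u)) (w := c⁻¹)
    (fun b => hc _)
    (fun b => b.rec target_mem_tracedGraph_verts base_mem_tracedGraph_verts)
    (fun b => (hqc _).trans (b.rec hz (by simp [powerPath])))
  have hE₀ : move (q 0) (.mk E) = cosetVertex (spanWords S) 1 := hE true
  have hE₁ : move (q (Fin.last k)) (.mk E) = cosetVertex (spanWords S) (.mk u) := hE false
  have hh : c * .mk E ∈ spanWords S := by
    rw [← cosetVertex_eq_one_iff, ← hE₀]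
    simp [hq, powerPath]
  refine ⟨D, E, by simpa using hDlength, hElength, hDletter, hEletter, c * .mk E, ⟨hh, ?_⟩, ?_⟩
  · refine mem_conjSubgroup_iff_cosetVertex_eq.mpr ?_
    rw [← move_cosetVertex, ← hz, move_mul]
    exact hE₁.trans hz.symm
  · have hqD : FreeGroup.mk D ∈ (schreier (spanWords S)).preorbit q :=
      mem_preorbit_schreier_iff.mpr hD
    funext i
    rw [powerPath_conj hh, move_mul]
    exact ((conj_mem_preorbit_iff hE₀).mp (by convert hqD using 1; group) i).symm

theorem exists_short_powerPath_eq_conj (hk : 1 ≤ k)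
    (hz : powerPath (spanWords S) k z (Fin.last k) = cosetVertex (spanWords S) (.mk u)) :
    ∃ w : List (Letter X), w.length ≤ 3 * (prefixList S u).length ^ (k + 1) ∧
      (∀ a ∈ w, a.1 ∈ letterList S u) ∧
      ∃ h ∈ spanWords S ⊓ conjSubgroup (spanWords S) (.mk u),
        powerPath (spanWords S) k (.mk w) = powerPath (spanWords S) k (h⁻¹ * z * h) := by
  obtain ⟨D, E, hDlength, hElength, hDletter, hEletter, h, hh, hpath⟩ :=
    exists_short_words_powerPath_eq_conj hk hz
  refine ⟨FreeGroup.invRev E ++ D ++ E, ?_, ?_, h, hh, ?_⟩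
  · have hpos : 1 ≤ (prefixList S u).length := List.length_pos_of_mem nil_mem_prefixList
    have hk₁ := Nat.pow_le_pow_right hpos (show k ≤ k + 1 by omega)
    have hk₂ := Nat.pow_le_pow_right hpos (show 2 ≤ k + 1 by omega)
    simp only [List.length_append, FreeGroup.invRev_length]
    omega
  · simp only [List.mem_append, or_imp, forall_and, FreeGroup.invRev, List.mem_reverse,
      List.forall_mem_map]
    exact ⟨⟨hEletter, hDletter⟩, hEletter⟩
  · rwa [← FreeGroup.mul_mk, ← FreeGroup.mul_mk, ← FreeGroup.inv_mk]

theorem exists_short_orbit_rep (hk : 1 ≤ k)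
    (hz : z ∈ preorderSet (rCoset (spanWords S) (.mk u)) k) :
    ∃ w : List (Letter X), w.length ≤ 3 * (prefixList S u).length ^ (k + 1) ∧
      (∀ a ∈ w, a.1 ∈ letterList S u) ∧
      FreeGroup.mk w ∈ preorderSet (rCoset (spanWords S) (.mk u)) k ∧
      z ∈ conjSet (orbitCoset (spanWords S) k (.mk w))
        ↑(spanWords S ⊓ conjSubgroup (spanWords S) (.mk u)) := by
  obtain ⟨w, hlength, hletter, h, hh, hw⟩ :=
    exists_short_powerPath_eq_conj hk ((mem_preorderSet_rCoset_iff hk).mp hz).2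
  have horbit : h⁻¹ * z * h ∈ orbitCoset (spanWords S) k (.mk w) := mem_orbitCoset_iff.mpr hw.symm
  exact ⟨w, hlength, hletter, (mem_preorderSet_iff_of_mem_orbitCoset hk horbit).mp
    ((conj_mem_preorderSet_iff hk hh).mpr hz), _, horbit, h⁻¹, inv_mem hh, by group⟩

/-- The list of all words of length at most `N` in the letters of `A` and their inverses. -/
def wordsUpTo (A : List X) (N : ℕ) : List (List (Letter X)) :=
  (List.range (N + 1)).flatMap (listsOfLength (A ×ˢ [true, false]))

theorem mem_wordsUpTo {A : List X} {N : ℕ} {w : List (Letter X)} :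
    w ∈ wordsUpTo A N ↔ w.length ≤ N ∧ ∀ a ∈ w, a.1 ∈ A := by
  simp [wordsUpTo, mem_listsOfLength]

open Classical in
/-- Representatives of the orbit cosets of all elements of order `k` in `H u`, where
`H = spanWords S`, up to conjugation by `H ∩ H ^ u`. The list is empty if `k = 0`. -/
noncomputable def orbitReps (S : List (List (Letter X))) (u : List (Letter X)) (k : ℕ) :
    List (List (Letter X)) :=
  ((wordsUpTo (letterList S u) (3 * (prefixList S u).length ^ (k + 1))).filter fun w =>
    1 ≤ k ∧ FreeGroup.mk w ∈ preorderSet (rCoset (spanWords S) (.mk u)) k).pwFilter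
      fun v w => FreeGroup.mk v ∉ orbitCoset (spanWords S) k (.mk w)

theorem mem_preorderSet_of_mem_orbitReps {w : List (Letter X)} (hw : w ∈ orbitReps S u k) :
    FreeGroup.mk w ∈ preorderSet (rCoset (spanWords S) (.mk u)) k := by
  classical
  exact (of_decide_eq_true (List.mem_filter.mp (List.pwFilter_subset _ hw)).2).2

theorem pairwise_disjoint_orbitReps : (orbitReps S u k).Pairwise fun v w =>
    Disjoint (orbitCoset (spanWords S) k (.mk v)) (orbitCoset (spanWords S) k (.mk w)) :=
  by classical exact (List.pairwise_pwFilter _).imp disjoint_orbitCoset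

theorem exists_mem_orbitReps {w : List (Letter X)} (hk : 1 ≤ k)
    (hlength : w.length ≤ 3 * (prefixList S u).length ^ (k + 1))
    (hletter : ∀ a ∈ w, a.1 ∈ letterList S u)
    (hw : FreeGroup.mk w ∈ preorderSet (rCoset (spanWords S) (.mk u)) k) :
    ∃ v ∈ orbitReps S u k, FreeGroup.mk w ∈ orbitCoset (spanWords S) k (.mk v) := by
  classical
  have htrans : ∀ v w z : List (Letter X), FreeGroup.mk v ∉ orbitCoset (spanWords S) k (.mk z) →
      FreeGroup.mk v ∉ orbitCoset (spanWords S) k (.mk w) ∨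
        FreeGroup.mk w ∉ orbitCoset (spanWords S) k (.mk z) := fun v w z h => by
    simp only [mem_orbitCoset_iff, ← not_and_or] at h ⊢
    exact fun h' => h (h'.1.trans h'.2)
  have hcand := List.mem_filter_of_mem (p := fun w => decide (1 ≤ k ∧
      FreeGroup.mk w ∈ preorderSet (rCoset (spanWords S) (.mk u)) k))
    (mem_wordsUpTo.mpr ⟨hlength, hletter⟩) (decide_eq_true ⟨hk, hw⟩)
  obtain ⟨v, hv, hwv⟩ :=
    exists_mem_pwFilter htrans hcand (not_not.mpr (mem_orbitCoset_iff.mpr rfl))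
  exact ⟨v, hv, not_not.mp hwv⟩

theorem preorderSet_eq_conjSet_orbitReps (hk : 1 ≤ k) :
    preorderSet (rCoset (spanWords S) (.mk u)) k =
      conjSet (⋃ w ∈ orbitReps S u k, orbitCoset (spanWords S) k (.mk w))
        ↑(spanWords S ⊓ conjSubgroup (spanWords S) (.mk u)) := by
  apply subset_antisymm
  · intro z hz
    obtain ⟨w, hlength, hletter, hw, g, hg, h, hh, rfl⟩ := exists_short_orbit_rep hk hz
    obtain ⟨v, hv, hvw⟩ := exists_mem_orbitReps hk hlength hletter hw
    exact ⟨g, Set.mem_biUnion hv (mem_orbitCoset_iff.mpr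
      ((mem_orbitCoset_iff.mp hg).trans (mem_orbitCoset_iff.mp hvw))), h, hh, rfl⟩
  · rintro _ ⟨g, hg, h, hh, rfl⟩
    obtain ⟨w, hw, hg⟩ := Set.mem_iUnion₂.mp hg
    exact conjSet_orbitCoset_subset hk (mem_preorderSet_of_mem_orbitReps hw) ⟨g, hg, h, hh, rfl⟩

variable [Primcodable X]

theorem primrec_invRev : Primrec (FreeGroup.invRev : List (Letter X) → List (Letter X)) :=
  Primrec.list_reverse.comp (Primrec.list_map .id (Primrec.pair (Primrec.fst.comp .snd)
    (Primrec.not.comp (Primrec.snd.comp .snd))))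

theorem primrec_wordsUpTo : Primrec₂ (wordsUpTo (X := X)) :=
  Primrec.list_flatMap (Primrec.list_range.comp (Primrec.succ.comp .snd))
    (primrec_listsOfLength.comp (primrec_list_product (Primrec.fst.comp .fst) (.const _)) .snd)

variable {α : Type*} [Primcodable α] {S : α → List (List (Letter X))}
  {u v w : α → List (Letter X)} {k : α → ℕ}

theorem primrec_wordPow (hw : Primrec w) (hk : Primrec k) :
    Primrec fun a => (List.replicate (k a) (w a)).flatten :=
  (Primrec.list_flatMap (g := fun a _ => w a) (Primrec.list_range.comp hk)
    (hw.comp .fst)).of_eq fun a => by rw [List.flatMap_def, List.map_const', List.length_range]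

theorem primrecPred_mul_inv_mem_spanWords (hS : Primrec S) (hv : Primrec v) (hw : Primrec w) :
    PrimrecPred fun a => FreeGroup.mk (v a) * (FreeGroup.mk (w a))⁻¹ ∈ spanWords (S a) :=
  (primrecPred_mem_spanWords hS (Primrec.list_append.comp hv (primrec_invRev.comp hw))).of_eq
    fun a => by rw [FreeGroup.inv_mk, FreeGroup.mul_mk]

theorem primrecPred_pow_mem_rCoset (hS : Primrec S) (hu : Primrec u) (hk : Primrec k)
    (hw : Primrec w) :
    PrimrecPred fun a => FreeGroup.mk (w a) ^ k a ∈ rCoset (spanWords (S a)) (.mk (u a)) :=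
  (primrecPred_mul_inv_mem_spanWords hS (primrec_wordPow hw hk) hu).of_eq fun a => by
    rw [mem_rCoset_iff, FreeGroup.pow_mk]

theorem primrecPred_mem_preorderSet (hS : Primrec S) (hu : Primrec u) (hk : Primrec k)
    (hw : Primrec w) :
    PrimrecPred fun a => 1 ≤ k a ∧
      FreeGroup.mk (w a) ∈ preorderSet (rCoset (spanWords (S a)) (.mk (u a))) (k a) := by
  have hlt := primrecPred_forall_lt (R := fun a j =>
      1 ≤ j → FreeGroup.mk (w a) ^ j ∉ rCoset (spanWords (S a)) (.mk (u a))) hk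
    (primrecPred_imp (Primrec.nat_le.comp (.const 1) .snd)
      (primrecPred_pow_mem_rCoset (hS.comp .fst) (hu.comp .fst) .snd (hw.comp .fst)).not)
  refine ((Primrec.nat_le.comp (.const 1) hk).and
    ((primrecPred_pow_mem_rCoset hS hu hk hw).and hlt)).of_eq fun a => and_congr_right fun hk => ?_
  rw [mem_preorderSet_iff hk]
  tauto

theorem primrecPred_mem_orbitCoset (hS : Primrec S) (hk : Primrec k) (hv : Primrec v)
    (hw : Primrec w) :
    PrimrecPred fun a => FreeGroup.mk (v a) ∈ orbitCoset (spanWords (S a)) (k a) (.mk (w a)) := by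
  refine (primrecPred_forall_lt (R := fun a j =>
      FreeGroup.mk (List.replicate j (v a)).flatten *
        (FreeGroup.mk (List.replicate j (w a)).flatten)⁻¹ ∈ spanWords (S a))
    (Primrec.succ.comp hk) (primrecPred_mul_inv_mem_spanWords
    (hS.comp .fst) (primrec_wordPow (hv.comp .fst) .snd)
    (primrec_wordPow (hw.comp .fst) .snd))).of_eq fun a => ?_
  simp only [mem_orbitCoset_iff, funext_iff, powerPath, Fin.forall_iff, ← FreeGroup.pow_mk,
    eq_comm (a := cosetVertex _ (FreeGroup.mk (v a) ^ _)), cosetVertex_eq_iff]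

theorem primrec_orbitReps (hS : Primrec S) (hu : Primrec u) (hk : Primrec k) :
    Primrec fun a => orbitReps (S a) (u a) (k a) := by
  classical
  refine (primrec_pwFilter (R := fun a v w =>
      FreeGroup.mk v ∉ orbitCoset (spanWords (S a)) (k a) (.mk w))
    (primrec_filter (R := fun a w => 1 ≤ k a ∧
      FreeGroup.mk w ∈ preorderSet (rCoset (spanWords (S a)) (.mk (u a))) (k a))
      (primrec_wordsUpTo.comp (primrec_letterList.comp hS hu) (Primrec.nat_mul.comp (.const 3)
        (primrec_natPow (Primrec.list_length.comp (primrec_prefixList.comp hS hu))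
          (Primrec.succ.comp hk))))
      (primrecPred_mem_preorderSet (hS.comp .fst) (hu.comp .fst) (hk.comp .fst) .snd))
    (primrecPred_mem_orbitCoset (hS.comp .fst) (hk.comp .fst) (Primrec.fst.comp .snd)
      (Primrec.snd.comp .snd)).not).of_eq fun a => ?_
  unfold orbitReps
  congr!

end OrbitCosets

/-! ### Schreier bases -/

section SchreierTrees

variable {X : Type*} {K : Subgroup (FreeGroup X)} {A : Set X} {T : Set (List (Letter X))}
  {s t L : List (Letter X)} {a : Letter X} {x : X}

/-- A Schreier tree of `K`: a prefix-closed set of words that represent different right cosets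
of `K`. -/
structure IsSchreierTree (K : Subgroup (FreeGroup X)) (T : Set (List (Letter X))) : Prop where
  nil_mem : [] ∈ T
  of_concat : ∀ {t a}, t ++ [a] ∈ T → t ∈ T
  injOn : T.InjOn fun t => cosetVertex K (.mk t)

/-- The triple `e = (s, x, t)` is a chord of the Schreier tree `T`: the Schreier automaton has an
arc `K s → K t` with label `x` that does not belong to the tree. -/
structure IsChord (K : Subgroup (FreeGroup X)) (T : Set (List (Letter X)))
    (e : List (Letter X) × X × List (Letter X)) : Prop where
  fst_mem : e.1 ∈ T
  snd_mem : e.2.2 ∈ T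
  move_eq : move (cosetVertex K (.mk e.1)) (.of e.2.1) = cosetVertex K (.mk e.2.2)
  not_isPrefixArc : ¬ IsPrefixArc e.2.1 e.1 e.2.2

/-- The Schreier generator `s x t⁻¹` of the chord `(s, x, t)`. -/
def chordWord (e : List (Letter X) × X × List (Letter X)) : List (Letter X) :=
  e.1 ++ [(e.2.1, true)] ++ FreeGroup.invRev e.2.2

theorem mk_chordWord (e : List (Letter X) × X × List (Letter X)) :
    FreeGroup.mk (chordWord e) = .mk e.1 * .of e.2.1 * (.mk e.2.2)⁻¹ := by
  rw [chordWord, ← FreeGroup.mul_mk, ← FreeGroup.mul_mk, FreeGroup.inv_mk, FreeGroup.of]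

theorem IsChord.mk_chordWord_mem {e : List (Letter X) × X × List (Letter X)}
    (he : IsChord K T e) : FreeGroup.mk (chordWord e) ∈ K := by
  rw [mk_chordWord, ← cosetVertex_eq_iff, ← he.move_eq, move_cosetVertex]

variable {ι : Type*} {e : ι → List (Letter X) × X × List (Letter X)}

open Classical in
/-- The free generator `i` on the arc `p → p x` of the Schreier automaton if this arc is the chord
`e i`, and `1` if it is not a chord. -/
noncomputable def chordCocycle (K : Subgroup (FreeGroup X))
    (e : ι → List (Letter X) × X × List (Letter X)) (x : X) (p : RightCosets K) : FreeGroup ι :=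
  if h : ∃ i, (e i).2.1 = x ∧ cosetVertex K (.mk (e i).1) = p then .of h.choose else 1

/-- The action of the free group that reads a word backwards in the covering of the Schreier
automaton given by `chordCocycle`: the permutation assigned to the letter `x` is the inverse of
`(p, y) ↦ (p x, y * chordCocycle K e x p)`. -/
noncomputable def chordAction (K : Subgroup (FreeGroup X))
    (e : ι → List (Letter X) × X × List (Letter X)) :
    FreeGroup X →* Equiv.Perm (RightCosets K × FreeGroup ι) :=
  FreeGroup.lift fun x => (Equiv.prodShear
    ⟨fun p => move p (.of x), fun p => move p (.of x)⁻¹,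
      fun p => by simp [← move_mul], fun p => by simp [← move_mul]⟩
    fun p => Equiv.mulRight (chordCocycle K e x p))⁻¹

theorem chordAction_of (p : RightCosets K) (y : FreeGroup ι) :
    chordAction K e (.of x) (move p (.of x), y * chordCocycle K e x p) = (p, y) := by
  rw [chordAction, FreeGroup.lift_apply_of, Equiv.Perm.inv_eq_iff_eq]
  rfl

theorem chordCocycle_of_isPrefixArc (hT : IsSchreierTree K T) (he : ∀ i, IsChord K T (e i))
    (hs : s ∈ T) (ht : t ∈ T) (h : IsPrefixArc x s t) :
    chordCocycle K e x (cosetVertex K (.mk s)) = 1 := by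
  refine dif_neg ?_
  rintro ⟨i, rfl, hi⟩
  obtain rfl : (e i).1 = s := hT.injOn (he i).fst_mem hs hi
  have hend : cosetVertex K (.mk (e i).2.2) = cosetVertex K (.mk t) := by
    rw [← (he i).move_eq, mk_eq_of_isPrefixArc h, move_cosetVertex, FreeGroup.of]
  obtain rfl : (e i).2.2 = t := hT.injOn (he i).snd_mem ht hend
  exact (he i).not_isPrefixArc h

theorem chordCocycle_chord (hT : IsSchreierTree K T) (he : ∀ i, IsChord K T (e i))
    (hinj : Function.Injective e) (i : ι) :
    chordCocycle K e (e i).2.1 (cosetVertex K (.mk (e i).1)) = .of i := by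
  have h : ∃ j, (e j).2.1 = (e i).2.1 ∧
      cosetVertex K (.mk (e j).1) = cosetVertex K (.mk (e i).1) := ⟨i, rfl, rfl⟩
  obtain ⟨hlabel, horigin⟩ := h.choose_spec
  refine (dif_pos h).trans (congrArg FreeGroup.of (hinj (Prod.ext ?_ (Prod.ext hlabel ?_))))
  · exact hT.injOn (he _).fst_mem (he i).fst_mem horigin
  · refine hT.injOn (he _).snd_mem (he i).snd_mem ?_
    simp only [← (he _).move_eq, hlabel, horigin]

theorem chordAction_of_isPrefixArc (hT : IsSchreierTree K T) (he : ∀ i, IsChord K T (e i))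
    (hs : s ∈ T) (ht : t ∈ T) (h : IsPrefixArc x s t) (y : FreeGroup ι) :
    chordAction K e (.of x) (cosetVertex K (.mk t), y) = (cosetVertex K (.mk s), y) := by
  have hact := chordAction_of (e := e) (x := x) (cosetVertex K (.mk s)) y
  rwa [chordCocycle_of_isPrefixArc hT he hs ht h, mul_one, move_cosetVertex, FreeGroup.of,
    ← mk_eq_of_isPrefixArc h] at hact

theorem chordAction_mk_of_mem (hT : IsSchreierTree K T) (he : ∀ i, IsChord K T (e i))
    (ht : t ∈ T) (y : FreeGroup ι) :
    chordAction K e (.mk t) (cosetVertex K (.mk t), y) = (cosetVertex K 1, y) := by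
  induction t using List.reverseRecOn with
  | nil => rw [← FreeGroup.one_eq_mk, map_one, Equiv.Perm.one_apply]
  | append_singleton t a ih =>
    have ht' := hT.of_concat ht
    rw [← ih ht', ← FreeGroup.mul_mk, map_mul, Equiv.Perm.mul_apply, FreeGroup.mul_mk]
    congr 1
    obtain ⟨x, b⟩ := a
    cases b with
    | true => exact chordAction_of_isPrefixArc hT he ht' ht (Or.inl rfl) y
    | false =>
      have hinv : FreeGroup.mk [(x, false)] = (FreeGroup.of x)⁻¹ := rfl
      rw [hinv, map_inv, Equiv.Perm.inv_eq_iff_eq]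
      exact (chordAction_of_isPrefixArc hT he ht ht' (Or.inr rfl) y).symm

theorem chordAction_chordWord (hT : IsSchreierTree K T) (he : ∀ i, IsChord K T (e i))
    (hinj : Function.Injective e) (i : ι) (y : FreeGroup ι) :
    chordAction K e (.mk (chordWord (e i))) (cosetVertex K 1, y) =
      (cosetVertex K 1, y * (.of i)⁻¹) := by
  have hsnd := chordAction_mk_of_mem hT he (he i).snd_mem y
  have hchord := chordAction_of (e := e) (x := (e i).2.1) (cosetVertex K (.mk (e i).1))
    (y * (.of i)⁻¹)
  rw [chordCocycle_chord hT he hinj, inv_mul_cancel_right, (he i).move_eq] at hchord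
  rw [mk_chordWord, map_mul, map_mul, map_inv, Equiv.Perm.mul_apply, Equiv.Perm.mul_apply,
    Equiv.Perm.inv_eq_iff_eq.mpr hsnd.symm, hchord, chordAction_mk_of_mem hT he (he i).fst_mem]

theorem chordAction_lift_chordWord (hT : IsSchreierTree K T) (he : ∀ i, IsChord K T (e i))
    (hinj : Function.Injective e) (z y : FreeGroup ι) :
    chordAction K e (FreeGroup.lift (fun i => .mk (chordWord (e i))) z) (cosetVertex K 1, y) =
      (cosetVertex K 1, y * z⁻¹) := by
  induction z using FreeGroup.induction_on generalizing y with
  | C1 => simp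
  | of i => rw [FreeGroup.lift_apply_of, chordAction_chordWord hT he hinj]
  | inv_of i _ =>
    rw [map_inv, map_inv, Equiv.Perm.inv_eq_iff_eq, FreeGroup.lift_apply_of,
      chordAction_chordWord hT he hinj, inv_inv, mul_inv_cancel_right]
  | mul z z' ih ih' =>
    rw [map_mul, map_mul, Equiv.Perm.mul_apply, ih', ih, mul_inv_rev, mul_assoc]

theorem injective_lift_chordWord (hT : IsSchreierTree K T) (he : ∀ i, IsChord K T (e i))
    (hinj : Function.Injective e) :
    Function.Injective (FreeGroup.lift fun i => FreeGroup.mk (chordWord (e i))) := by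
  refine (injective_iff_map_eq_one _).mpr fun z hz => ?_
  have hact := chordAction_lift_chordWord hT he hinj z 1
  rw [hz, map_one, Equiv.Perm.one_apply, one_mul] at hact
  exact inv_eq_one.mp (congrArg Prod.snd hact).symm

theorem mul_inv_mem_closure_chordWord_of_move_of_eq
    (hsurj : ∀ d, IsChord K T d → d.2.1 ∈ A → ∃ i, e i = d) (hs : s ∈ T) (ht : t ∈ T) (hx : x ∈ A)
    (h : move (cosetVertex K (.mk s)) (.of x) = cosetVertex K (.mk t)) :
    FreeGroup.mk s * .of x * (.mk t)⁻¹ ∈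
      Subgroup.closure (Set.range fun i => FreeGroup.mk (chordWord (e i))) := by
  by_cases harc : IsPrefixArc x s t
  · rw [mk_eq_of_isPrefixArc harc, FreeGroup.of, mul_inv_cancel]
    exact one_mem _
  · obtain ⟨i, hi⟩ := hsurj (s, x, t) ⟨hs, ht, h, harc⟩ hx
    rw [← mk_chordWord (s, x, t), ← hi]
    exact Subgroup.subset_closure ⟨i, rfl⟩

theorem mul_inv_mem_closure_chordWord_of_move_mk_eq
    (hsurj : ∀ d, IsChord K T d → d.2.1 ∈ A → ∃ i, e i = d) (hs : s ∈ T) (ht : t ∈ T)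
    (ha : a.1 ∈ A) (h : move (cosetVertex K (.mk s)) (.mk [a]) = cosetVertex K (.mk t)) :
    FreeGroup.mk s * .mk [a] * (.mk t)⁻¹ ∈
      Subgroup.closure (Set.range fun i => FreeGroup.mk (chordWord (e i))) := by
  obtain ⟨x, b⟩ := a
  cases b with
  | true => exact mul_inv_mem_closure_chordWord_of_move_of_eq hsurj hs ht ha h
  | false =>
    have hinv : FreeGroup.mk [(x, false)] = (FreeGroup.of x)⁻¹ := rfl
    have hmem := mul_inv_mem_closure_chordWord_of_move_of_eq hsurj ht hs ha
      (move_eq_iff.mpr (by rw [← h, hinv]))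
    convert inv_mem hmem using 1
    rw [hinv]
    group

theorem mul_inv_mem_closure_chordWord (hT : IsSchreierTree K T)
    (hsurj : ∀ d, IsChord K T d → d.2.1 ∈ A → ∃ i, e i = d) (hA : ∀ a ∈ L, a.1 ∈ A)
    (hcov : ∀ M, M <+: L → ∃ t ∈ T, cosetVertex K (.mk M) = cosetVertex K (.mk t))
    (ht : t ∈ T) (h : cosetVertex K (.mk L) = cosetVertex K (.mk t)) :
    FreeGroup.mk L * (.mk t)⁻¹ ∈
      Subgroup.closure (Set.range fun i => FreeGroup.mk (chordWord (e i))) := by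
  induction L using List.reverseRecOn generalizing t with
  | nil =>
    rw [hT.injOn hT.nil_mem ht h, mul_inv_cancel]
    exact one_mem _
  | append_singleton L a ih =>
    obtain ⟨s, hs, hLs⟩ := hcov L (List.prefix_append L [a])
    have hmem := ih (fun b hb => hA b (by simp [hb]))
      (fun M hM => hcov M (hM.trans (List.prefix_append L [a]))) hs hLs
    have hlast := mul_inv_mem_closure_chordWord_of_move_mk_eq hsurj hs ht (hA a (by simp))
      (by rw [← h, ← hLs, move_cosetVertex, FreeGroup.mul_mk])
    convert mul_mem hmem hlast using 1
    rw [← FreeGroup.mul_mk]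
    group

theorem isFreeBasisOf_chordWord (hT : IsSchreierTree K T) (he : ∀ i, IsChord K T (e i))
    (hinj : Function.Injective e) (hsurj : ∀ d, IsChord K T d → d.2.1 ∈ A → ∃ i, e i = d)
    (hcov : ∀ w ∈ K, ∃ L, FreeGroup.mk L = w ∧ (∀ a ∈ L, a.1 ∈ A) ∧
      ∀ M, M <+: L → ∃ t ∈ T, cosetVertex K (.mk M) = cosetVertex K (.mk t)) :
    IsFreeBasisOf (fun i => FreeGroup.mk (chordWord (e i))) K := by
  have hrange : (FreeGroup.lift fun i => FreeGroup.mk (chordWord (e i))).range = K := by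
    rw [FreeGroup.range_lift_eq_closure]
    refine le_antisymm ((Subgroup.closure_le _).mpr ?_) fun w hw => ?_
    · rintro _ ⟨i, rfl⟩
      exact (he i).mk_chordWord_mem
    · obtain ⟨L, rfl, hA, hL⟩ := hcov w hw
      simpa [← FreeGroup.one_eq_mk] using mul_inv_mem_closure_chordWord hT hsurj hA hL hT.nil_mem
        (by rwa [← FreeGroup.one_eq_mk, cosetVertex_eq_one_iff])
  refine ⟨⟨((MonoidHom.ofInjective (injective_lift_chordWord hT he hinj)).trans
    (MulEquiv.subgroupCongr hrange)).symm⟩, fun i => ?_⟩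
  change FreeGroup.lift (fun i => FreeGroup.mk (chordWord (e i))) (.of i) = _
  exact FreeGroup.lift_apply_of

end SchreierTrees

section ComputedBasis

variable {X : Type*} {K : Subgroup (FreeGroup X)} {A : List X} {N : ℕ} {t : List (Letter X)}

/-- The words `t a` with `t ∈ T` and a letter `a` of `A` or its inverse. -/
def wordExtensions (A : List X) (T : List (List (Letter X))) : List (List (Letter X)) :=
  T.flatMap fun t => (A ×ˢ [true, false]).map fun a => t ++ [a]

theorem mem_wordExtensions {T : List (List (Letter X))} {a : Letter X} :
    t ++ [a] ∈ wordExtensions A T ↔ t ∈ T ∧ a.1 ∈ A := by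
  simp [wordExtensions, Prod.ext_iff]

open Classical in
/-- A Schreier tree whose words represent the right cosets of `K` that contain a word of length at
most `N` in the letters of `A` and their inverses. -/
noncomputable def schreierTree (K : Subgroup (FreeGroup X)) (A : List X) :
    ℕ → List (List (Letter X))
  | 0 => [[]]
  | N + 1 => (wordExtensions A (schreierTree K A N) ++ schreierTree K A N).pwFilter
      fun s t => cosetVertex K (.mk s) ≠ cosetVertex K (.mk t)

theorem pairwise_schreierTree : (schreierTree K A N).Pairwise fun s t =>
    cosetVertex K (.mk s) ≠ cosetVertex K (.mk t) := by
  classical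
  cases N with
  | zero => exact List.pairwise_singleton _ _
  | succ N => exact List.pairwise_pwFilter _

theorem schreierTree_subset_succ : schreierTree K A N ⊆ schreierTree K A (N + 1) := by
  classical
  exact subset_pwFilter_append pairwise_schreierTree

theorem nil_mem_schreierTree : [] ∈ schreierTree K A N := by
  induction N with
  | zero => exact List.mem_singleton.mpr rfl
  | succ N ih => exact schreierTree_subset_succ ih

theorem isSchreierTree_schreierTree : IsSchreierTree K {t | t ∈ schreierTree K A N} where
  nil_mem := nil_mem_schreierTree
  of_concat {t a} ht := by
    classical
    induction N with
    | zero => simp [schreierTree] at ht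
    | succ N ih =>
      refine schreierTree_subset_succ ?_
      rcases List.mem_append.mp (List.pwFilter_subset _ ht) with hnew | hold
      · exact (mem_wordExtensions.mp hnew).1
      · exact ih hold
  injOn := List.inj_on_of_nodup_map (List.pairwise_map.mpr pairwise_schreierTree)

theorem exists_mem_schreierTree (hlength : t.length ≤ N) (hletter : ∀ a ∈ t, a.1 ∈ A) :
    ∃ s ∈ schreierTree K A N, cosetVertex K (.mk t) = cosetVertex K (.mk s) := by
  classical
  induction N generalizing t with
  | zero => exact ⟨t, by simpa [schreierTree] using hlength, rfl⟩
  | succ N ih =>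
    rcases List.eq_nil_or_concat' t with rfl | ⟨t, a, rfl⟩
    · exact ⟨[], nil_mem_schreierTree, rfl⟩
    obtain ⟨s, hs, hts⟩ := ih (t := t) (by simpa using hlength) fun b hb => hletter b (by simp [hb])
    have ha : s ++ [a] ∈ wordExtensions A (schreierTree K A N) ++ schreierTree K A N :=
      List.mem_append_left _ (mem_wordExtensions.mpr ⟨hs, hletter a (by simp)⟩)
    obtain ⟨r, hr, hsr⟩ := exists_mem_pwFilter
      (R := fun s t => cosetVertex K (.mk s) ≠ cosetVertex K (.mk t))
      (fun _ _ _ h => not_and_or.mp fun h' => h (h'.1.trans h'.2)) ha (not_not.mpr rfl)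
    refine ⟨r, hr, ?_⟩
    rw [← not_not.mp hsr, ← FreeGroup.mul_mk, ← move_cosetVertex, hts, move_cosetVertex,
      FreeGroup.mul_mk]

open Classical in
/-- The chords of the tree `T` whose label belongs to `A`. -/
noncomputable def treeChords (K : Subgroup (FreeGroup X)) (A : List X)
    (T : List (List (Letter X))) : List (List (Letter X) × X × List (Letter X)) :=
  ((T ×ˢ A ×ˢ T).filter fun e => cosetVertex K (.mk (e.1 ++ [(e.2.1, true)])) =
    cosetVertex K (.mk e.2.2) ∧ ¬ IsPrefixArc e.2.1 e.1 e.2.2).dedup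

theorem mem_treeChords {T : List (List (Letter X))}
    {e : List (Letter X) × X × List (Letter X)} :
    e ∈ treeChords K A T ↔ IsChord K {t | t ∈ T} e ∧ e.2.1 ∈ A := by
  classical
  rw [treeChords, List.mem_dedup, List.mem_filter, List.mem_product, List.mem_product,
    decide_eq_true_iff, ← FreeGroup.mul_mk, ← move_cosetVertex]
  exact ⟨fun h => ⟨⟨h.1.1, h.1.2.2, h.2.1, h.2.2⟩, h.1.2.1⟩,
    fun h => ⟨⟨h.1.fst_mem, h.2, h.1.snd_mem⟩, h.1.move_eq, h.1.not_isPrefixArc⟩⟩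

/-- The Schreier generators of `K` that are given by the chords of `schreierTree K A N`. -/
noncomputable def schreierBasis (K : Subgroup (FreeGroup X)) (A : List X) (N : ℕ) :
    List (List (Letter X)) :=
  (treeChords K A (schreierTree K A N)).map chordWord

theorem isFreeBasisOf_schreierBasis
    (hcov : ∀ w ∈ K, ∃ L, FreeGroup.mk L = w ∧ (∀ a ∈ L, a.1 ∈ A) ∧
      ∀ M, M <+: L → ∃ t : List (Letter X), t.length ≤ N ∧ (∀ a ∈ t, a.1 ∈ A) ∧
        cosetVertex K (.mk M) = cosetVertex K (.mk t)) :
    IsFreeBasisOf (fun i : Fin (schreierBasis K A N).length =>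
      FreeGroup.mk ((schreierBasis K A N).get i)) K := by
  classical
  have hlength : (schreierBasis K A N).length =
    (treeChords K A (schreierTree K A N)).length := List.length_map _
  let e := fun i : Fin (schreierBasis K A N).length =>
    (treeChords K A (schreierTree K A N)).get (i.cast hlength)
  have he : (fun i => FreeGroup.mk ((schreierBasis K A N).get i)) =
      fun i => FreeGroup.mk (chordWord (e i)) :=
    funext fun i => congrArg FreeGroup.mk (List.getElem_map chordWord)
  rw [he]
  refine isFreeBasisOf_chordWord (A := {x | x ∈ A}) isSchreierTree_schreierTree
    (fun i => (mem_treeChords.mp (List.get_mem _ _)).1) (fun i j hij => Fin.cast_injective hlength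
      (List.nodup_iff_injective_get.mp (List.nodup_dedup _) hij)) (fun d hd hA => ?_)
    fun w hw => ?_
  · obtain ⟨i, hi⟩ := List.get_of_mem (mem_treeChords.mpr ⟨hd, hA⟩)
    exact ⟨i.cast hlength.symm, hi⟩
  · obtain ⟨L, hLw, hA, hL⟩ := hcov w hw
    refine ⟨L, hLw, hA, fun M hM => ?_⟩
    obtain ⟨t, hlength, hletter, hMt⟩ := hL M hM
    obtain ⟨s, hs, hts⟩ := exists_mem_schreierTree hlength hletter
    exact ⟨s, hs, hMt.trans hts⟩

theorem cosetVertex_inf_conjSubgroup_eq_iff {H : Subgroup (FreeGroup X)} {g g' u : FreeGroup X} :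
    cosetVertex (H ⊓ conjSubgroup H u) g = cosetVertex (H ⊓ conjSubgroup H u) g' ↔
      cosetVertex H g = cosetVertex H g' ∧ cosetVertex H (u * g) = cosetVertex H (u * g') := by
  simp only [cosetVertex_eq_iff, Subgroup.mem_inf, mem_conjSubgroup_iff, mul_inv_rev, mul_assoc]

variable {S : List (List (Letter X))} {u w M : List (Letter X)}

theorem tracedGraph_isWalk_of_mem_inf_conjSubgroup (hred : FreeGroup.IsReduced w)
    (hw : FreeGroup.mk w ∈ spanWords S ⊓ conjSubgroup (spanWords S) (.mk u)) (b : Bool) :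
    (tracedGraph S u).IsWalk (cosetVertex (spanWords S) (bif b then .mk u else 1)) w
      (cosetVertex (spanWords S) (bif b then .mk u else 1)) := by
  cases b with
  | true =>
    refine tracedGraph_isWalk_of_move_eq hred target_mem_tracedGraph_verts
      target_mem_tracedGraph_verts ?_
    rw [cond_true, move_cosetVertex]
    exact mem_conjSubgroup_iff_cosetVertex_eq.mp hw.2
  | false =>
    refine tracedGraph_isWalk_of_move_eq hred base_mem_tracedGraph_verts
      base_mem_tracedGraph_verts ?_
    rw [cond_false, move_cosetVertex, one_mul]
    exact cosetVertex_eq_one_iff.mpr hw.1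

theorem exists_short_word_of_prefix (hred : FreeGroup.IsReduced w)
    (hw : FreeGroup.mk w ∈ spanWords S ⊓ conjSubgroup (spanWords S) (.mk u)) (hM : M <+: w) :
    ∃ t : List (Letter X), t.length ≤ (prefixList S u).length ^ 2 ∧
      (∀ a ∈ t, a.1 ∈ letterList S u) ∧
      cosetVertex (spanWords S ⊓ conjSubgroup (spanWords S) (.mk u)) (.mk M) =
        cosetVertex (spanWords S ⊓ conjSubgroup (spanWords S) (.mk u)) (.mk t) := by
  obtain ⟨M', rfl⟩ := hM
  have hwalk := tracedGraph_isWalk_of_mem_inf_conjSubgroup hred hw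
  choose c hc _ using fun b => InvDigraph.isWalk_append_iff.mp (hwalk b)
  obtain ⟨t, hlength, hletter, ht⟩ := exists_short_word (fun b => (hwalk b).left_mem)
    (fun b => (hc b).right_mem) (fun b => (move_eq_of_tracedGraph_isWalk (hc b)).1)
  have hcoset (b : Bool) := (move_eq_of_tracedGraph_isWalk (hc b)).1.trans (ht b).symm
  refine ⟨t, hlength, hletter, cosetVertex_inf_conjSubgroup_eq_iff.mpr ⟨?_, hcoset true⟩⟩
  simpa using hcoset false

theorem isFreeBasisOf_schreierBasis_inf_conjSubgroup (S : List (List (Letter X)))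
    (u : List (Letter X)) :
    letI B := schreierBasis (spanWords S ⊓ conjSubgroup (spanWords S) (.mk u)) (letterList S u)
      ((prefixList S u).length ^ 2)
    IsFreeBasisOf (fun i : Fin B.length => FreeGroup.mk (B.get i))
      (spanWords S ⊓ conjSubgroup (spanWords S) (.mk u)) := by
  classical
  refine isFreeBasisOf_schreierBasis fun w hw => ?_
  rw [← w.mk_toWord] at hw
  exact ⟨w.toWord, w.mk_toWord, (move_eq_of_tracedGraph_isWalk
    (tracedGraph_isWalk_of_mem_inf_conjSubgroup FreeGroup.isReduced_toWord hw true)).2,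
    fun M hM => exists_short_word_of_prefix FreeGroup.isReduced_toWord hw hM⟩

variable [Primcodable X] {α : Type*} [Primcodable α] {K : α → Subgroup (FreeGroup X)}
  {A : α → List X}

theorem primrecPred_cosetVertex_eq {v w : α → List (Letter X)}
    (hK : PrimrecPred fun p : α × List (Letter X) => FreeGroup.mk p.2 ∈ K p.1)
    (hv : Primrec v) (hw : Primrec w) :
    PrimrecPred fun a => cosetVertex (K a) (.mk (v a)) = cosetVertex (K a) (.mk (w a)) :=
  (hK.comp (Primrec.id.pair (Primrec.list_append.comp hw (primrec_invRev.comp hv)))).of_eq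
    fun a => by rw [cosetVertex_eq_iff, FreeGroup.inv_mk, FreeGroup.mul_mk]; rfl

theorem primrec_wordExtensions : Primrec₂ (wordExtensions (X := X)) :=
  Primrec.list_flatMap .snd (Primrec.list_map
    (primrec_list_product (Primrec.fst.comp .fst) (.const _))
    (Primrec.list_concat.comp (Primrec.snd.comp .fst) .snd).to₂)

theorem primrec_schreierTree {N : α → ℕ}
    (hK : PrimrecPred fun p : α × List (Letter X) => FreeGroup.mk p.2 ∈ K p.1)
    (hA : Primrec A) (hN : Primrec N) : Primrec fun a => schreierTree (K a) (A a) (N a) := by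
  classical
  have hne : PrimrecPred fun p : (α × ℕ × List (List (Letter X))) × List (Letter X) ×
      List (Letter X) =>
        cosetVertex (K p.1.1) (.mk p.2.1) ≠ cosetVertex (K p.1.1) (.mk p.2.2) :=
    (primrecPred_cosetVertex_eq (K := fun p : (α × ℕ × List (List (Letter X))) ×
      List (Letter X) × List (Letter X) => K p.1.1)
      (hK.comp ((Primrec.fst.comp (Primrec.fst.comp .fst)).pair .snd))
      (Primrec.fst.comp .snd) (Primrec.snd.comp .snd)).not
  refine (Primrec.nat_rec' hN (.const [[]]) (primrec_pwFilter (R := fun p s t =>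
    cosetVertex (K p.1) (.mk s) ≠ cosetVertex (K p.1) (.mk t)) (Primrec.list_append.comp
      (primrec_wordExtensions.comp (hA.comp .fst) (Primrec.snd.comp .snd))
      (Primrec.snd.comp .snd)) hne).to₂).of_eq fun a => ?_
  induction N a with
  | zero => rfl
  | succ N ih => simp only [schreierTree, ← ih]

theorem primrec_treeChords {T : α → List (List (Letter X))}
    (hK : PrimrecPred fun p : α × List (Letter X) => FreeGroup.mk p.2 ∈ K p.1)
    (hA : Primrec A) (hT : Primrec T) : Primrec fun a => treeChords (K a) (A a) (T a) := by
  classical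
  have hfst := Primrec.fst (α := List (Letter X)) (β := X × List (Letter X))
  have hlabel := Primrec.fst.comp (Primrec.snd (α := List (Letter X))
    (β := X × List (Letter X)))
  have hsnd := Primrec.snd.comp (Primrec.snd (α := List (Letter X)) (β := X × List (Letter X)))
  have hchord : PrimrecPred fun p : α × List (Letter X) × X × List (Letter X) =>
      cosetVertex (K p.1) (.mk (p.2.1 ++ [(p.2.2.1, true)])) =
        cosetVertex (K p.1) (.mk p.2.2.2) ∧ ¬ IsPrefixArc p.2.2.1 p.2.1 p.2.2.2 :=
    (primrecPred_cosetVertex_eq (K := fun p : α × List (Letter X) × X × List (Letter X) => K p.1)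
      (hK.comp ((Primrec.fst.comp .fst).pair .snd))
      (Primrec.list_concat.comp (hfst.comp .snd) ((hlabel.comp .snd).pair (.const true)))
      (hsnd.comp .snd)).and
    (primrecPred_isPrefixArc (hlabel.comp .snd) (hfst.comp .snd) (hsnd.comp .snd)).not
  refine (primrec_pwFilter (R := fun _ d e => d ≠ e) (primrec_filter (R := fun a
      (e : List (Letter X) × X × List (Letter X)) =>
      cosetVertex (K a) (.mk (e.1 ++ [(e.2.1, true)])) = cosetVertex (K a) (.mk e.2.2) ∧
        ¬ IsPrefixArc e.2.1 e.1 e.2.2)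
    (primrec_list_product hT (primrec_list_product hA hT)) hchord)
    (Primrec.eq.comp (Primrec.fst.comp .snd) (Primrec.snd.comp .snd)).not).of_eq fun a => ?_
  unfold treeChords List.dedup
  congr!

theorem primrec_schreierBasis {N : α → ℕ}
    (hK : PrimrecPred fun p : α × List (Letter X) => FreeGroup.mk p.2 ∈ K p.1)
    (hA : Primrec A) (hN : Primrec N) : Primrec fun a => schreierBasis (K a) (A a) (N a) :=
  Primrec.list_map (primrec_treeChords hK hA (primrec_schreierTree hK hA hN))
    (Primrec.list_append.comp (Primrec.list_concat.comp (Primrec.fst.comp .snd)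
      ((Primrec.fst.comp (Primrec.snd.comp .snd)).pair (.const true)))
      (primrec_invRev.comp (Primrec.snd.comp (Primrec.snd.comp .snd))))

end ComputedBasis

/-! ### The algorithm -/

section Algorithm

variable {X : Type*} {S : List (List (Letter X))} {u : List (Letter X)} {k : ℕ}

open Classical in
/-- The algorithm that computes `F_k(H u)` from the input `(S, u, k)`, where `H = spanWords S`: it
returns representatives of the orbit cosets and a free basis of `H ∩ H ^ u`, or `none` if
`F_k(H u)` is empty. -/
noncomputable def preorderAlgorithm (x : List (List (Letter X)) × List (Letter X) × ℕ) :
    Option (List (List (Letter X)) × List (List (Letter X))) :=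
  if orbitReps x.1 x.2.1 x.2.2 = [] then none
  else some (orbitReps x.1 x.2.1 x.2.2,
    schreierBasis (spanWords x.1 ⊓ conjSubgroup (spanWords x.1) (.mk x.2.1))
      (letterList x.1 x.2.1) ((prefixList x.1 x.2.1).length ^ 2))

theorem preorderSet_eq_empty_of_preorderAlgorithm_eq_none (hk : 1 ≤ k)
    (h : preorderAlgorithm (S, u, k) = none) :
    preorderSet (rCoset (spanWords S) (.mk u)) k = ∅ := by
  have hreps : orbitReps S u k = [] := by
    by_contra hne
    simp [preorderAlgorithm, hne] at h
  rw [preorderSet_eq_conjSet_orbitReps hk, hreps]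
  simp [conjSet]

theorem eq_of_preorderAlgorithm_eq_some {ws B : List (List (Letter X))}
    (h : preorderAlgorithm (S, u, k) = some (ws, B)) : ws ≠ [] ∧ ws = orbitReps S u k ∧
      B = schreierBasis (spanWords S ⊓ conjSubgroup (spanWords S) (.mk u)) (letterList S u)
        ((prefixList S u).length ^ 2) := by
  by_cases hreps : orbitReps S u k = []
  · simp [preorderAlgorithm, hreps] at h
  · simp only [preorderAlgorithm, hreps, if_false, Option.some.injEq, Prod.mk.injEq] at h
    obtain ⟨rfl, rfl⟩ := h
    exact ⟨hreps, rfl, rfl⟩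

variable [Primcodable X]

theorem primrecPred_mem_inf_conjSubgroup {α : Type*} [Primcodable α]
    {S : α → List (List (Letter X))} {u w : α → List (Letter X)} (hS : Primrec S) (hu : Primrec u)
    (hw : Primrec w) : PrimrecPred fun a =>
      FreeGroup.mk (w a) ∈ spanWords (S a) ⊓ conjSubgroup (spanWords (S a)) (.mk (u a)) :=
  ((primrecPred_mem_spanWords hS hw).and (primrecPred_mul_inv_mem_spanWords hS
    (Primrec.list_append.comp hu hw) hu)).of_eq fun a => by
      rw [Subgroup.mem_inf, mem_conjSubgroup_iff, FreeGroup.mul_mk]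

theorem computable_preorderAlgorithm : Computable (preorderAlgorithm (X := X)) := by
  classical
  have hS := Primrec.fst (α := List (List (Letter X))) (β := List (Letter X) × ℕ)
  have hu := Primrec.fst.comp (Primrec.snd (α := List (List (Letter X)))
    (β := List (Letter X) × ℕ))
  have hreps := primrec_orbitReps hS hu (Primrec.snd.comp .snd)
  have hbasis := primrec_schreierBasis
    (K := fun x : List (List (Letter X)) × List (Letter X) × ℕ =>
      spanWords x.1 ⊓ conjSubgroup (spanWords x.1) (.mk x.2.1))
    (primrecPred_mem_inf_conjSubgroup (hS.comp .fst) (hu.comp .fst) .snd)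
    (primrec_letterList.comp hS hu) (primrec_natPow
      (Primrec.list_length.comp (primrec_prefixList.comp hS hu)) (.const 2))
  exact ((Primrec.ite (Primrec.eq.comp hreps (.const [])) (.const none)
    (Primrec.option_some.comp (hreps.pair hbasis))).of_eq fun x => by
      unfold preorderAlgorithm; congr!).to_comp

end Algorithm

theorem mainTheorem6_general {X : Type*} [Primcodable X] :
    (∃ f : List (List (Letter X)) × List (Letter X) × ℕ →
        Option (List (List (Letter X)) × List (List (Letter X))),
      Computable f ∧
      ∀ (S : List (List (Letter X))) (u : List (Letter X)) (k : ℕ), 1 ≤ k →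
        (f (S, u, k) = none →
          preorderSet (rCoset (spanWords S) (FreeGroup.mk u)) k = ∅) ∧
        ∀ ws B : List (List (Letter X)), f (S, u, k) = some (ws, B) →
          (preorderSet (rCoset (spanWords S) (FreeGroup.mk u)) k).Nonempty ∧
          (∀ w ∈ ws, FreeGroup.mk w ∈
            preorderSet (rCoset (spanWords S) (FreeGroup.mk u)) k) ∧
          IsFreeBasisOf (fun i : Fin B.length => FreeGroup.mk (B.get i))
            (spanWords S ⊓ conjSubgroup (spanWords S) (FreeGroup.mk u)) ∧
          ws.Pairwise (fun w w' => Disjoint (orbitCoset (spanWords S) k (FreeGroup.mk w))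
            (orbitCoset (spanWords S) k (FreeGroup.mk w'))) ∧
          preorderSet (rCoset (spanWords S) (FreeGroup.mk u)) k =
            conjSet (⋃ w ∈ ws, orbitCoset (spanWords S) k (FreeGroup.mk w))
              ((spanWords S ⊓ conjSubgroup (spanWords S) (FreeGroup.mk u) :
                Subgroup (FreeGroup X)) : Set (FreeGroup X))) ∧
    ComputablePred (fun x : List (List (Letter X)) × List (Letter X) × ℕ ×
        List (Letter X) =>
      1 ≤ x.2.2.1 ∧ FreeGroup.mk x.2.2.2 ∈
        preorderSet (rCoset (spanWords x.1) (FreeGroup.mk x.2.1)) x.2.2.1) ∧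
    (∀ (H : Subgroup (FreeGroup X)), H.FG → ∀ (u : FreeGroup X) (k : ℕ), 1 ≤ k →
      {q : Fin (k + 1) → RightCosets H | (cosetStallings H u).IsTrail q}.Finite ∧
      ∀ v v' : (Fin (k + 1) → RightCosets H) → FreeGroup X,
        (∀ q, (cosetStallings H u).IsTrail q →
          (schreier H).Reads (q 0) (v q) (cosetVertex H 1) ∧
          (schreier H).Reads (q (Fin.last k)) (v' q) (cosetVertex H u)) →
        ((fun q => conjSet ((schreier H).preorbit q)
            (lCoset (v q) H ∩ lCoset (v' q) (conjSubgroup H u))) ''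
          {q : Fin (k + 1) → RightCosets H |
            (cosetStallings H u).IsTrail q}).PairwiseDisjoint id ∧
        preorderSet (rCoset H u) k =
          ⋃ q ∈ {q : Fin (k + 1) → RightCosets H | (cosetStallings H u).IsTrail q},
            conjSet ((schreier H).preorbit q)
              (lCoset (v q) H ∩ lCoset (v' q) (conjSubgroup H u))) ∧
    (∀ (H : Subgroup (FreeGroup X)), H.FG → ∀ k : ℕ, 1 ≤ k →
      {q : Fin (k + 1) → RightCosets H | (restrictedStallings H).IsClosedTrail q}.Finite ∧
      ∀ v : (Fin (k + 1) → RightCosets H) → FreeGroup X,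
        (∀ q, (restrictedStallings H).IsClosedTrail q →
          (schreier H).Reads (q 0) (v q) (cosetVertex H 1)) →
        ((fun q => conjSet ((schreier H).preorbit q) {v q}) ''
          {q : Fin (k + 1) → RightCosets H |
            (restrictedStallings H).IsClosedTrail q}).PairwiseDisjoint id ∧
        preorderSet (H : Set (FreeGroup X)) k =
          conjSet
            (⋃ q ∈ {q : Fin (k + 1) → RightCosets H | (restrictedStallings H).IsClosedTrail q},
              conjSet ((schreier H).preorbit q) {v q})
            (H : Set (FreeGroup X))) := by
  refine ⟨⟨preorderAlgorithm, computable_preorderAlgorithm, fun S u k hk =>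
    ⟨preorderSet_eq_empty_of_preorderAlgorithm_eq_none hk, fun ws B h => ?_⟩⟩, ?_,
    fun H hH u k hk => ⟨finite_setOf_isTrail (finite_cosetStallings_verts hH u), fun v v' h => ?_⟩,
    fun H hH k hk => ⟨finite_setOf_isClosedTrail_restrictedStallings hH, fun v h => ?_⟩⟩
  · obtain ⟨hne, rfl, rfl⟩ := eq_of_preorderAlgorithm_eq_some h
    obtain ⟨w, hw⟩ := List.exists_mem_of_ne_nil _ hne
    exact ⟨⟨_, mem_preorderSet_of_mem_orbitReps hw⟩, fun _ => mem_preorderSet_of_mem_orbitReps,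
      isFreeBasisOf_schreierBasis_inf_conjSubgroup S u, pairwise_disjoint_orbitReps,
      preorderSet_eq_conjSet_orbitReps hk⟩
  · exact (primrecPred_mem_preorderSet .fst (Primrec.fst.comp .snd)
      (Primrec.fst.comp (Primrec.snd.comp .snd)) (Primrec.snd.comp
        (Primrec.snd.comp .snd))).computablePred
  · have hv := fun q hq => schreier_reads_iff.mp (h q hq).1
    have hv' := fun q hq => schreier_reads_iff.mp (h q hq).2
    exact ⟨pairwiseDisjoint_trail_conjSet hv hv', preorderSet_eq_iUnion_trails hk hv hv'⟩
  · have hv := fun q hq => schreier_reads_iff.mp (h q hq)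
    exact ⟨pairwiseDisjoint_closedTrail_conjSet hv,
      preorderSet_eq_conjSet_iUnion_closedTrails hk hv⟩

theorem mainTheorem6 (n : ℕ) :
    -- one algorithm, uniform in the generators of `H`, in `u` and in `k`
    (∃ f : List (List (Letter (Fin n))) × List (Letter (Fin n)) × ℕ →
        Option (List (List (Letter (Fin n))) × List (List (Letter (Fin n)))),
      Computable f ∧
      ∀ (S : List (List (Letter (Fin n)))) (u : List (Letter (Fin n))) (k : ℕ), 1 ≤ k →
        (f (S, u, k) = none →
          preorderSet (rCoset (spanWords S) (FreeGroup.mk u)) k = ∅) ∧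
        ∀ ws B : List (List (Letter (Fin n))), f (S, u, k) = some (ws, B) →
          (preorderSet (rCoset (spanWords S) (FreeGroup.mk u)) k).Nonempty ∧
          (∀ w ∈ ws, FreeGroup.mk w ∈
            preorderSet (rCoset (spanWords S) (FreeGroup.mk u)) k) ∧
          IsFreeBasisOf (fun i : Fin B.length => FreeGroup.mk (B.get i))
            (spanWords S ⊓ conjSubgroup (spanWords S) (FreeGroup.mk u)) ∧
          ws.Pairwise (fun w w' => Disjoint (orbitCoset (spanWords S) k (FreeGroup.mk w))
            (orbitCoset (spanWords S) k (FreeGroup.mk w'))) ∧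
          preorderSet (rCoset (spanWords S) (FreeGroup.mk u)) k =
            conjSet (⋃ w ∈ ws, orbitCoset (spanWords S) k (FreeGroup.mk w))
              ((spanWords S ⊓ conjSubgroup (spanWords S) (FreeGroup.mk u) :
                Subgroup (FreeGroup (Fin n))) : Set (FreeGroup (Fin n)))) ∧
    -- the set of elements of order `k` in `H u` is computable
    ComputablePred (fun x : List (List (Letter (Fin n))) × List (Letter (Fin n)) × ℕ ×
        List (Letter (Fin n)) =>
      1 ≤ x.2.2.1 ∧ FreeGroup.mk x.2.2.2 ∈
        preorderSet (rCoset (spanWords x.1) (FreeGroup.mk x.2.1)) x.2.2.1) ∧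
    -- the description through the trails of length `k` in the coset Stallings automaton
    (∀ (H : Subgroup (FreeGroup (Fin n))), H.FG → ∀ (u : FreeGroup (Fin n)) (k : ℕ), 1 ≤ k →
      {q : Fin (k + 1) → RightCosets H | (cosetStallings H u).IsTrail q}.Finite ∧
      ∀ v v' : (Fin (k + 1) → RightCosets H) → FreeGroup (Fin n),
        (∀ q, (cosetStallings H u).IsTrail q →
          (schreier H).Reads (q 0) (v q) (cosetVertex H 1) ∧
          (schreier H).Reads (q (Fin.last k)) (v' q) (cosetVertex H u)) →
        ((fun q => conjSet ((schreier H).preorbit q)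
            (lCoset (v q) H ∩ lCoset (v' q) (conjSubgroup H u))) ''
          {q : Fin (k + 1) → RightCosets H |
            (cosetStallings H u).IsTrail q}).PairwiseDisjoint id ∧
        preorderSet (rCoset H u) k =
          ⋃ q ∈ {q : Fin (k + 1) → RightCosets H | (cosetStallings H u).IsTrail q},
            conjSet ((schreier H).preorbit q)
              (lCoset (v q) H ∩ lCoset (v' q) (conjSubgroup H u))) ∧
    -- the subgroup case, through the closed trails in the restricted Stallings automaton
    (∀ (H : Subgroup (FreeGroup (Fin n))), H.FG → ∀ k : ℕ, 1 ≤ k →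
      {q : Fin (k + 1) → RightCosets H | (restrictedStallings H).IsClosedTrail q}.Finite ∧
      ∀ v : (Fin (k + 1) → RightCosets H) → FreeGroup (Fin n),
        (∀ q, (restrictedStallings H).IsClosedTrail q →
          (schreier H).Reads (q 0) (v q) (cosetVertex H 1)) →
        ((fun q => conjSet ((schreier H).preorbit q) {v q}) ''
          {q : Fin (k + 1) → RightCosets H |
            (restrictedStallings H).IsClosedTrail q}).PairwiseDisjoint id ∧
        preorderSet (H : Set (FreeGroup (Fin n))) k =
          conjSet
            (⋃ q ∈ {q : Fin (k + 1) → RightCosets H | (restrictedStallings H).IsClosedTrail q},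
              conjSet ((schreier H).preorbit q) {v q})
            (H : Set (FreeGroup (Fin n)))) :=
  mainTheorem6_general
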